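/- **Theorem.** Let the *swap-tracking problem on five elements* be the following decision problem. Its alphabet consists of the ten tokens $[x\leftrightarrow y]$ with $1\le x<y\le 5$, where $[x\leftrightarrow y]$ denotes the transposition of $x$ and $y$ in $S_5$; a word belongs to the language if and only if the composition of its transpositions is the identity permutation. *The model.* An RWKV-7 model of dimension $D=hN$ ($h$ heads of size $N$) maps each token to an embedding vector in $\mathbb R^D$, applies a layer normalization, passes the resulting sequence through layers, and then applies a layer normalization and a linear output head. Each layer consists of two residual blocks: $x\mapsto x+\mathrm{TimeMix}(\mathrm{LN}(x))$ followed by $x\mapsto x+\mathrm{MLP}(\mathrm{LN}(x))$. All arithmetic is exact real arithmetic. Vectors are row vectors, $\odot$ is the coordinatewise product, and $\mathrm{lerp}(a,b,\mu)=a+(b-a)\odot\mu$. Layer normalization is $\mathrm{LN}(x)=\gamma\odot\frac{x-\mathrm{mean}(x)}{\sqrt{\mathrm{var}(x)+\varepsilon}}+\beta$ with trainable $\gamma,\beta$ (with $0/0=0$). For an input sequence $x_1,x_2,\dots$ of a block (and $x_0=0$) and trainable $\mu_\square$, put $x^\square_t=\mathrm{lerp}(x_t,x_{t-1},\mu_\square)$.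 In time mixing (first layer), $$a_t=\sigma(x^a_tA_aB_a+\lambda_a),\quad k_t=x^k_tW_k,\quad \kappa_t=k_t\odot\xi,\quad \tilde k_t=k_t\odot\mathrm{lerp}(1,a_t,\alpha),\quad v_t=x^v_tW_v,$$ $$w_t=\exp\bigl(-e^{-1/2}\sigma(\tanh(x^d_tA_d)B_d+\lambda_d)\bigr),\quad r_t=x^r_tW_r,\quad g_t=\sigma(x^g_tA_g)B_g,$$ where $\sigma$ is the logistic sigmoid. (In later layers $v_t$ is an interpolation between the value $x^v_tW_v$ of that layer and that of the first layer.) These vectors are split into $h$ heads; in each head, with $\hat\kappa_t=\kappa_t/\|\kappa_t\|_2$ (and $\hat\kappa_t=0$ if $\kappa_t=0$), $$\mathbf{wkv}_0=0,\qquad \mathbf{wkv}_t=\mathbf{wkv}_{t-1}\bigl(\mathrm{diag}(w_t)-c\,\hat\kappa_t^{T}(a_t\odot\hat\kappa_t)\bigr)+v_t^{T}\tilde k_t,$$ $$p_t=\mathrm{LN}'(r_t\mathbf{wkv}_t^{T})+\bigl(r_t(\rho\odot\tilde k_t)^T\bigr)v_t,$$ and the heads are recombined to give the output $(g_t\odot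 p_t)W_o$ of the block. Here $\mathrm{LN}'$ is the layer normalization of a head, with stabilizing constant $\varepsilon'$ in place of $\varepsilon$. The MLP block is $\mathrm{ReLU}(x'_tW_{k'})^2W_{v'}$ with $x'_t=\mathrm{lerp}(x_t,x_{t-1},\mu')$ and hidden dimension $4D$. The output head has two logits, labelled $0$ and $1$; after reading a sequence the model *outputs* the label whose logit at the last position is strictly larger. *Circuit classes.* $\mathsf{NC}^1$, $\mathsf{TC}^0$ and $\mathsf{AC}^0$ are the non-uniform classes of decision problems over finite alphabets that are defined by families of polynomial-size Boolean circuits (one for each input length, with letters encoded one-hot), of depth $O(\log n)$ with negations and with conjunctions and disjunctions of fan-in at most two ($\mathsf{NC}^1$); of depth $O(1)$ with negations and with conjunctions and disjunctions of unbounded fan-in ($\mathsf{AC}^0$); and of depth $O(1)$ with, in addition, majority gates of unbounded fan-in ($\mathsf{TC}^0$). An $\mathsf{AC}^0$ reduction is a many-one reduction computed by an $\mathsf{AC}^0$ circuit family, such that the length of the output word depends only on the length of the input word and is polynomially bounded. Then: 1. With $c=2$ and for all constants $\varepsilon,\varepsilon'\ge 0$, there is a one-layer RWKV-7 model that solves the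 swap-tracking problem on five elements: for every finite sequence of swap tokens (of any length), preceded by a special beginning-of-sequence token $\#$, the model outputs $1$ if the swaps compose to the identity permutation, and $0$ otherwise. 2. The swap-tracking problem on five elements is $\mathsf{NC}^1$-complete under $\mathsf{AC}^0$ reductions. 3. Consequently, if $\mathsf{TC}^0\neq\mathsf{NC}^1$, then this problem, which RWKV-7 with $c=2$ solves, is not in $\mathsf{TC}^0$. -/

import Mathlib

open scoped Matrix

/-! ### Boolean circuits and the classes `NC¹`, `AC⁰`, `TC⁰` -/

namespace CircuitComplexity

/-- A gate of a circuit with `s` gates and input variables indexed by `ι`. A gate reads a finite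
set of gates. The constants are the conjunction and the disjunction of fan-in `0`. -/
inductive Gate (ι : Type) (s : ℕ) : Type
  | input (i : ι)
  | not (j : Fin s)
  | and (J : Finset (Fin s))
  | or (J : Finset (Fin s))
  | maj (J : Finset (Fin s))

/-- The gates that a gate reads; their number is its fan-in. -/
def Gate.args {ι : Type} {s : ℕ} : Gate ι s → Finset (Fin s)
  | .input _ => ∅
  | .not j => {j}
  | .and J => J
  | .or J => J
  | .maj J => J

/-- Input gates contribute nothing to the depth, all other gates contribute one. -/
def Gate.cost {ι : Type} {s : ℕ} : Gate ι s → ℕ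
  | .input _ => 0
  | _ => 1

/-- The value of a gate, given the values `x` of the input variables and `v` of all gates.
A majority gate is true if at least half of the gates it reads are true. -/
def Gate.value {ι : Type} {s : ℕ} (x : ι → Bool) (v : Fin s → Bool) : Gate ι s → Bool
  | .input i => x i
  | .not j => !(v j)
  | .and J => decide (∀ j ∈ J, v j = true)
  | .or J => decide (∃ j ∈ J, v j = true)
  | .maj J => decide (J.card ≤ 2 * (J.filter (fun j => v j = true)).card)

/-- The gates allowed in `AC⁰` circuits: negation, conjunction and disjunction of any fan-in. -/
def Gate.IsBoolean {ι : Type} {s : ℕ} : Gate ι s → Prop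
  | .maj _ => False
  | _ => True

/-- A circuit (a directed acyclic graph of gates, listed in a topological order) with input
variables indexed by `ι` and outputs indexed by `Ω`. -/
structure Circuit (ι Ω : Type) where
  size : ℕ
  gate : Fin size → Gate ι size
  acyclic : ∀ i, ∀ j ∈ (gate i).args, j < i
  out : Ω → Fin size

namespace Circuit

variable {ι Ω : Type}

/-- The value of gate number `i`; the fallback value `false` is never read, by acyclicity. -/
def gateValue (C : Circuit ι Ω) (x : ι → Bool) (i : Fin C.size) : Bool :=
  (C.gate i).value x (fun j => if j < i then C.gateValue x j else false)
termination_by i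

/-- The depth of gate number `i`: the number of non-input gates on a longest path ending in it. -/
def gateDepth (C : Circuit ι Ω) (i : Fin C.size) : ℕ :=
  (C.gate i).args.sup (fun j => if j < i then C.gateDepth j else 0) + (C.gate i).cost
termination_by i

/-- The depth of a circuit: the largest depth of a gate. -/
def depth (C : Circuit ι Ω) : ℕ := Finset.univ.sup C.gateDepth

/-- The value of the output `o` on the input `x`. -/
def eval (C : Circuit ι Ω) (x : ι → Bool) (o : Ω) : Bool := C.gateValue x (C.out o)

/-- The value of a gate is the value of its operation at the values of the gates it reads. -/
theorem gateValue_eq (C : Circuit ι Ω) (x : ι → Bool) (i : Fin C.size) :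
    C.gateValue x i = (C.gate i).value x (C.gateValue x) := by
  have key : ∀ (g : Gate ι C.size), (∀ j ∈ g.args, j < i) →
      g.value x (fun j => if j < i then C.gateValue x j else false)
        = g.value x (C.gateValue x) := by
    intro g hg
    cases g with
    | input a => rfl
    | not j => simp [Gate.value, hg j (by simp [Gate.args])]
    | and J =>
      have h : ∀ j ∈ J, j < i := hg
      simp only [Gate.value]
      congr 1
      exact propext (forall₂_congr fun j hj => by simp [h j hj])
    | or J =>
      have h : ∀ j ∈ J, j < i := hg
      simp only [Gate.value]
      congr 1
      exact propext (exists_congr fun j => and_congr_right fun hj => by simp [h j hj])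
    | maj J =>
      have h : ∀ j ∈ J, j < i := hg
      simp only [Gate.value]
      rw [Finset.filter_congr (fun j hj => by simp [h j hj] :
        ∀ j ∈ J, ((if j < i then C.gateValue x j else false) = true) ↔
          C.gateValue x j = true)]
  rw [gateValue]
  exact key _ (C.acyclic i)

/-- The depth of a gate in terms of the depths of the gates it reads. -/
theorem gateDepth_eq (C : Circuit ι Ω) (i : Fin C.size) :
    C.gateDepth i = (C.gate i).args.sup C.gateDepth + (C.gate i).cost := by
  rw [gateDepth]
  congr 1
  exact Finset.sup_congr rfl fun j hj => by simp [C.acyclic i j hj]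

end Circuit

/-- A decision problem: a language over a finite alphabet. -/
structure DecisionProblem where
  alphabet : Type
  finite : Finite alphabet
  language : Language alphabet

/-- The word `w` of length `n` as the input of a circuit: the variable `(i, a)` tells whether the
letter of `w` at position `i` is `a`. -/
noncomputable def letters {A : Type} {n : ℕ} (w : Fin n → A) : Fin n × A → Bool :=
  open Classical in fun p => decide (w p.1 = p.2)

/-- Polynomial growth. -/
def PolyBounded (s : ℕ → ℕ) : Prop := ∃ p : Polynomial ℕ, ∀ n, s n ≤ p.eval n

/-- A (non-uniform) family of circuits, one for each input length, decides a problem. -/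
def Decides (P : DecisionProblem) (C : ∀ n, Circuit (Fin n × P.alphabet) Unit) : Prop :=
  ∀ (n : ℕ) (w : Fin n → P.alphabet),
    (C n).eval (letters w) () = true ↔ List.ofFn w ∈ P.language

/-- `NC¹`: polynomial size, logarithmic depth, negations and conjunctions and disjunctions of
fan-in at most two. -/
def NC1 : Set DecisionProblem :=
  {P | ∃ C : ∀ n, Circuit (Fin n × P.alphabet) Unit,
    Decides P C ∧ PolyBounded (fun n => (C n).size) ∧
    (∃ d : ℕ, ∀ n, (C n).depth ≤ d * (Nat.log 2 n + 1)) ∧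
    ∀ n i, ((C n).gate i).IsBoolean ∧ ((C n).gate i).args.card ≤ 2}

/-- `TC⁰`: polynomial size, constant depth, negations and conjunctions, disjunctions and
majorities of unbounded fan-in. -/
def TC0 : Set DecisionProblem :=
  {P | ∃ C : ∀ n, Circuit (Fin n × P.alphabet) Unit,
    Decides P C ∧ PolyBounded (fun n => (C n).size) ∧ ∃ d : ℕ, ∀ n, (C n).depth ≤ d}

/-- `P` reduces to `Q` by a many-one reduction computed by an `AC⁰` family of circuits
(polynomial size, constant depth, negations and conjunctions and disjunctions of unbounded fan-in).
A word `w` of length `n` is mapped to the word `f n w` of length `l n`, and the output `(j, b)` of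
the circuit tells whether the letter of `f n w` at position `j` is `b`. -/
def AC0Reduces (P Q : DecisionProblem) : Prop :=
  ∃ (l : ℕ → ℕ) (f : ∀ n, (Fin n → P.alphabet) → (Fin (l n) → Q.alphabet))
    (C : ∀ n, Circuit (Fin n × P.alphabet) (Fin (l n) × Q.alphabet)),
    PolyBounded l ∧ PolyBounded (fun n => (C n).size) ∧
    (∃ d : ℕ, ∀ n, (C n).depth ≤ d) ∧ (∀ n i, ((C n).gate i).IsBoolean) ∧
    (∀ n w, (C n).eval (letters w) = letters (f n w)) ∧
    ∀ n w, List.ofFn w ∈ P.language ↔ List.ofFn (f n w) ∈ Q.language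

/-- `NC¹`-completeness under `AC⁰` reductions. -/
def NC1Complete (Q : DecisionProblem) : Prop := Q ∈ NC1 ∧ ∀ P ∈ NC1, AC0Reduces P Q

/-- A token `[x ↔ y]` with `x < y`, denoting a swap of two of the five elements. -/
abbrev Swap : Type := {p : Fin 5 × Fin 5 // p.1 < p.2}

/-- The permutation that a swap token denotes. -/
def Swap.perm (s : Swap) : Equiv.Perm (Fin 5) := Equiv.swap s.1.1 s.1.2

/-- The problem of tracking swaps on five elements: does a sequence of swaps compose to the
identity permutation? -/
def swapTracking : DecisionProblem where
  alphabet := Swap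
  finite := inferInstance
  language := {w | (w.map Swap.perm).prod = 1}

end CircuitComplexity

/-! ### The RWKV-7 architecture

All vectors are row vectors, so that a matrix `W` acts by `x ᵥ* W`. -/

noncomputable section

namespace RWKV7

/-- The channels of a model of dimension `D = h * N` that is split into `h` heads of size `N`. -/
abbrev Channel (h N : ℕ) : Type := Fin h × Fin N

/-- A vector of the model dimension. -/
abbrev Vec (h N : ℕ) : Type := Channel h N → ℝ

/-- A sequence of vectors; the first token has position `0`. -/
abbrev Stream (h N : ℕ) : Type := ℕ → Vec h N

/-- `lerp(a, b, x) = a + (b - a) ⊙ x`. -/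
def lerp {ι : Type} (a b x : ι → ℝ) : ι → ℝ := a + (b - a) * x

/-- The mean of the coordinates of a vector. -/
def mean {ι : Type} [Fintype ι] (x : ι → ℝ) : ℝ := (∑ i, x i) / Fintype.card ι

/-- The (biased) variance of the coordinates of a vector. -/
def var {ι : Type} [Fintype ι] (x : ι → ℝ) : ℝ := (∑ i, (x i - mean x) ^ 2) / Fintype.card ι

/-- Layer normalization with weight `γ`, bias `β` and stabilizing constant `ε`. -/
def layerNorm {ι : Type} [Fintype ι] (ε : ℝ) (γ β x : ι → ℝ) : ι → ℝ :=
  fun i => (x i - mean x) / √(var x + ε) * γ i + β i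

/-- Trainable weight and bias of a layer normalization over the model dimension. -/
structure NormParams (h N : ℕ) where
  γ : Vec h N
  β : Vec h N

/-- The layer normalization with given trainable parameters. -/
def NormParams.apply {h N : ℕ} (P : NormParams h N) (ε : ℝ) (x : Vec h N) : Vec h N :=
  layerNorm ε P.γ P.β x

/-- Trainable matrices of a low-rank two-layer perceptron. -/
structure LoraMLP (h N : ℕ) where
  rank : ℕ
  A : Matrix (Channel h N) (Fin rank) ℝ
  B : Matrix (Fin rank) (Channel h N) ℝ

/-- `f(x A) B`, with `f` applied coordinatewise. -/
def LoraMLP.apply {h N : ℕ} (P : LoraMLP h N) (f : ℝ → ℝ) (x : Vec h N) : Vec h N :=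
  (fun i => f ((x ᵥ* P.A) i)) ᵥ* P.B

/-- The trainable parameters of one layer: a time mixing block and a channel mixing block (MLP),
each preceded by a layer normalization. The parameters of the value residual gate `ν` have no
effect in the first layer. -/
structure LayerParams (h N : ℕ) where
  lnTime : NormParams h N
  μr : Vec h N
  μk : Vec h N
  μv : Vec h N
  μd : Vec h N
  μa : Vec h N
  μg : Vec h N
  loraA : LoraMLP h N
  biasA : Vec h N
  loraν : LoraMLP h N
  biasν : Vec h N
  loraD : LoraMLP h N
  biasD : Vec h N
  loraG : LoraMLP h N
  Wk : Matrix (Channel h N) (Channel h N) ℝ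
  Wv : Matrix (Channel h N) (Channel h N) ℝ
  Wr : Matrix (Channel h N) (Channel h N) ℝ
  Wo : Matrix (Channel h N) (Channel h N) ℝ
  ξ : Vec h N
  α : Vec h N
  ρ : Vec h N
  lnHead : NormParams h N
  lnChan : NormParams h N
  μk' : Vec h N
  Wk' : Matrix (Channel h N) (Fin (4 * (h * N))) ℝ
  Wv' : Matrix (Fin (4 * (h * N))) (Channel h N) ℝ

/-- The previous element of a sequence, the zero vector before the first token. -/
def prev {h N : ℕ} (x : Stream h N) : Stream h N
  | 0 => 0
  | t + 1 => x t

/-- Token shift: interpolation between the current and the previous element of a sequence. -/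
def shift {h N : ℕ} (μ : Vec h N) (x : Stream h N) : Stream h N :=
  fun t => lerp (x t) (prev x t) μ

/-- The transition matrix `diag(w) - c κ̂ᵀ (a ⊙ κ̂)` of one head; the number `c` is the global
multiplier of the in-context learning rate. -/
def transition {N : ℕ} (c : ℝ) (w κ a : Fin N → ℝ) : Matrix (Fin N) (Fin N) ℝ :=
  Matrix.diagonal w - c • Matrix.vecMulVec κ (a * κ)

/-- The state of one head: it is zero initially, and
`wkv_t = wkv_{t-1} (diag(w_t) - c κ̂_tᵀ (a_t ⊙ κ̂_t)) + v_tᵀ k_t`.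
Here `wkv (t + 1)` is the state after the token at position `t` has been read. -/
def wkv {N : ℕ} (c : ℝ) (w κ a v k : ℕ → Fin N → ℝ) : ℕ → Matrix (Fin N) (Fin N) ℝ
  | 0 => 0
  | t + 1 => wkv c w κ a v k t * transition c (w t) (κ t) (a t) + Matrix.vecMulVec (v t) (k t)

/-- Euclidean normalization of a vector; the zero vector is kept. -/
def normalize {N : ℕ} (κ : Fin N → ℝ) : Fin N → ℝ := fun i => κ i / √(∑ j, κ j ^ 2)

namespace LayerParams

variable {h N : ℕ} (P : LayerParams h N) (x : Stream h N)

/-- In-context learning rate. -/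
def iclr : Stream h N :=
  fun t i => Real.sigmoid (P.loraA.apply id (shift P.μa x t) i + P.biasA i)

/-- Key precursor. -/
def key : Stream h N := fun t => shift P.μk x t ᵥ* P.Wk

/-- Removal key. -/
def removalKey : Stream h N := fun t => P.key x t * P.ξ

/-- Replacement key. -/
def replacementKey : Stream h N := fun t => P.key x t * lerp 1 (P.iclr x t) P.α

/-- Value residual gate. -/
def valueGate : Stream h N :=
  fun t i => Real.sigmoid (P.loraν.apply id (shift P.μv x t) i + P.biasν i)

/-- Value precursor. -/
def valuePre : Stream h N := fun t => shift P.μv x t ᵥ* P.Wv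

/-- Value. The argument `v₀` is the value precursor of the first layer; it is `none` in the first
layer itself. -/
def value (v₀ : Option (Stream h N)) : Stream h N :=
  match v₀ with
  | none => P.valuePre x
  | some v => fun t => lerp (v t) (P.valuePre x t) (P.valueGate x t)

/-- Decay. -/
def decay : Stream h N := fun t i =>
  Real.exp (-Real.exp (-(1 / 2)) *
    Real.sigmoid (P.loraD.apply Real.tanh (shift P.μd x t) i + P.biasD i))

/-- Receptance. -/
def receptance : Stream h N := fun t => shift P.μr x t ᵥ* P.Wr

/-- Output gate. -/
def gate : Stream h N := fun t => P.loraG.apply Real.sigmoid (shift P.μg x t)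

/-- The state of head `j` after the first `t` tokens. -/
def state (c : ℝ) (v₀ : Option (Stream h N)) (j : Fin h) : ℕ → Matrix (Fin N) (Fin N) ℝ :=
  wkv c (fun t i => P.decay x t (j, i)) (fun t => normalize fun i => P.removalKey x t (j, i))
    (fun t i => P.iclr x t (j, i)) (fun t i => P.value x v₀ t (j, i))
    (fun t i => P.replacementKey x t (j, i))

/-- The bonus of head `j`: `(r_t · (ρ ⊙ k_t)ᵀ) v_t`. -/
def bonus (v₀ : Option (Stream h N)) (t : ℕ) (j : Fin h) : Fin N → ℝ :=
  fun i => (∑ m, P.receptance x t (j, m) * (P.ρ (j, m) * P.replacementKey x t (j, m))) *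
    P.value x v₀ t (j, i)

/-- The attention result: per head, the normalized readout `r_t wkv_tᵀ` plus the bonus. -/
def attention (c ε : ℝ) (v₀ : Option (Stream h N)) : Stream h N := fun t p =>
  layerNorm ε (fun i => P.lnHead.γ (p.1, i)) (fun i => P.lnHead.β (p.1, i))
    ((fun i => P.receptance x t (p.1, i)) ᵥ* (P.state x c v₀ p.1 (t + 1))ᵀ) p.2
    + P.bonus x v₀ t p.1 p.2

/-- The time mixing block. -/
def timeMix (c ε : ℝ) (v₀ : Option (Stream h N)) : Stream h N := fun t =>
  (P.gate x t * P.attention x c ε v₀ t) ᵥ* P.Wo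

/-- The channel mixing block, a two-layer perceptron with activation `ReLU²`. -/
def channelMix : Stream h N := fun t =>
  (fun i => max ((shift P.μk' x t ᵥ* P.Wk') i) 0 ^ 2) ᵥ* P.Wv'

/-- One layer with its two residual connections. It acts on the residual stream and on the value
precursor of the first layer. The constant `ε` belongs to the layer normalizations over the model
dimension, the constant `ε'` to the normalization of the heads. -/
def step (c ε ε' : ℝ) (s : Stream h N × Option (Stream h N)) :
    Stream h N × Option (Stream h N) :=
  let y : Stream h N := fun t => P.lnTime.apply ε (s.1 t)
  let z : Stream h N := s.1 + P.timeMix y c ε' s.2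
  (z + P.channelMix (fun t => P.lnChan.apply ε (z t)), some (s.2.getD (P.valuePre y)))

end LayerParams

/-- An RWKV-7 model with token vocabulary `V` and output vocabulary `O`. -/
structure Model (V O : Type) where
  heads : ℕ
  headSize : ℕ
  numLayers : ℕ
  embedding : V → Vec heads headSize
  lnPre : NormParams heads headSize
  layers : Fin numLayers → LayerParams heads headSize
  lnOut : NormParams heads headSize
  head : Matrix (Channel heads headSize) O ℝ

namespace Model

variable {V O : Type} (M : Model V O)

/-- The normalized embeddings of a sequence of tokens. (Positions after the end of the sequence
are filled with zeros; they have no influence on earlier positions.) -/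
def embed (ε : ℝ) (w : List V) : Stream M.heads M.headSize :=
  fun t => (w[t]?).elim 0 fun a => M.lnPre.apply ε (M.embedding a)

/-- The residual stream after the last layer. -/
def residual (c ε ε' : ℝ) (w : List V) : Stream M.heads M.headSize :=
  ((List.ofFn M.layers).foldl (fun s P => P.step c ε ε' s) (M.embed ε w, none)).1

/-- The logits of the model after it has read the last token of a nonempty sequence. -/
def logits (c ε ε' : ℝ) (w : List V) : O → ℝ :=
  M.lnOut.apply ε (M.residual c ε ε' w (w.length - 1)) ᵥ* M.head

/-- After reading `w`, the model outputs `o`: the logit of `o` is the largest one, without ties. -/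
def Outputs (c ε ε' : ℝ) (w : List V) (o : O) : Prop :=
  ∀ o', o' ≠ o → M.logits c ε ε' w o' < M.logits c ε ε' w o

end Model

/-- The sequence of tokens that encodes a word: the beginning-of-sequence token `none`, and then
the letters of the word. -/
def encode {A : Type} (w : List A) : List (Option A) := none :: w.map some

/-- The model solves the membership problem of a language: on every word (preceded by the
beginning-of-sequence token) it outputs `1` if the word is in the language and `0` otherwise. -/
def Model.Solves {A : Type} (M : Model (Option A) (Fin 2)) (c ε ε' : ℝ) (L : Language A) : Prop :=
  ∀ w : List A, (w ∈ L → M.Outputs c ε ε' (encode w) 1) ∧ (w ∉ L → M.Outputs c ε ε' (encode w) 0)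

end RWKV7

end

/-!
**The model.** A swap of coordinates `i` and `j` is the Householder reflection in `e_i - e_j`. With
multiplier `2`, a removal key proportional to `e_i - e_j`, and the decay and the in-context learning
rate set to the same constant `b`, the transition matrix of a head is `b` times this swap
(`vecMul_transition_swap`). The beginning-of-sequence token writes a rank-one matrix whose key is
`(1, 2, 3, 4, 5, 1, …)`, and the letters write nothing, so that after a word with composition `π`
the state carries the key permuted by `π`, scaled by a power of `b` (`IsInput.state_eq`). The
receptance is a positive multiple of `(1, 2, 3, 4, 5, -54.5, …)`; its product with the permuted key
is `∑ i * π i - 54.5`, up to a positive factor, which is `0.5` for `π = 1` and at most `-0.5`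
otherwise. All further operations are sign-preserving: layer normalization only centres and
rescales by a positive number (`exists_layerNorm_eq`), so the exponential decay of the state does no
harm and the logit of the label `1` has the correct sign.

**Completeness.** Both `NC¹` and `TC⁰` problems have formulas of logarithmic depth: circuits unfold
gate by gate, since every gate computes a symmetric function of its arguments, and symmetric
functions of `m` arguments have depth `O(log m)` (`HasDepth.of_card_filter`) by a tree of carry-save
adders. Conversely, formulas of logarithmic depth have polynomially many subformulas
(`Circuit.exists_of_hasDepth`). A product of permutations is computed by divide and conquer, where
each level has constant depth because the group is finite (`HasDepth.of_determined`). Hardness is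
Barrington's theorem (`exists_program`), with 3-cycles in place of 5-cycles: a 3-cycle of five
points is a commutator of two 3-cycles and a product of two swaps. Each letter of the reduction
depends on at most one input variable.

**Separation.** Composition of circuits shows that `TC⁰` is closed under `AC⁰` reductions, so swap
tracking in `TC⁰` would give `NC¹ ⊆ TC⁰`, and `TC⁰ ⊆ NC¹` holds by the above.
-/

namespace CircuitComplexity

/-! ### Boolean formulas -/

/-- Boolean formulas in the variables `ι`. Disjunction is left out: it is expressed by negation
and conjunction at the price of a constant factor in the depth. -/
inductive Formula (ι : Type) : Type
  | const (b : Bool)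
  | var (i : ι)
  | not (F : Formula ι)
  | and (F G : Formula ι)

namespace Formula

variable {ι : Type}

/-- The depth of a formula; leaves have depth `0`. -/
def depth : Formula ι → ℕ
  | const _ => 0
  | var _ => 0
  | not F => F.depth + 1
  | and F G => max F.depth G.depth + 1

/-- The value of a formula. -/
def eval (x : ι → Bool) : Formula ι → Bool
  | const b => b
  | var i => x i
  | not F => !(F.eval x)
  | and F G => F.eval x && G.eval x

end Formula

/-- The Boolean function `g` on `X` is computed by a formula of depth at most `d`, where the
points of `X` are presented to the formula in the encoding `enc`. -/
def HasDepth {ι X : Type} (enc : X → ι → Bool) (g : X → Bool) (d : ℕ) : Prop :=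
  ∃ F : Formula ι, F.depth ≤ d ∧ ∀ x, F.eval (enc x) = g x

namespace HasDepth

variable {ι X : Type} {enc : X → ι → Bool}

theorem mono {g : X → Bool} {d d' : ℕ} (h : HasDepth enc g d) (hd : d ≤ d') :
    HasDepth enc g d' :=
  let ⟨F, hF, hg⟩ := h
  ⟨F, hF.trans hd, hg⟩

theorem congr {g g' : X → Bool} {d : ℕ} (h : HasDepth enc g d) (hg : ∀ x, g x = g' x) :
    HasDepth enc g' d :=
  (funext hg : g = g') ▸ h

theorem const (b : Bool) (d : ℕ) : HasDepth enc (fun _ => b) d :=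
  ⟨.const b, Nat.zero_le _, fun _ => rfl⟩

theorem var (i : ι) (d : ℕ) : HasDepth enc (fun x => enc x i) d :=
  ⟨.var i, Nat.zero_le _, fun _ => rfl⟩

theorem ite {f g₁ g₀ : X → Bool} {d : ℕ} (hf : HasDepth enc f d) (h₁ : HasDepth enc g₁ d)
    (h₀ : HasDepth enc g₀ d) : HasDepth enc (fun x => if f x then g₁ x else g₀ x) (d + 5) := by
  obtain ⟨F, hF, hf⟩ := hf
  obtain ⟨G₁, hG₁, h₁⟩ := h₁
  obtain ⟨G₀, hG₀, h₀⟩ := h₀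
  -- `(f ∧ g₁) ∨ (¬f ∧ g₀)`, by De Morgan
  refine ⟨.not (.and (.not (.and F G₁)) (.not (.and (.not F) G₀))), ?_, fun x => ?_⟩
  · simp only [Formula.depth]
    omega
  · simp only [Formula.eval, hf, h₁, h₀]
    cases f x <;> simp

/-- Shannon expansion: a function of `L` bits costs depth `O(L)` on top of the bits. -/
theorem comp_bits {L : ℕ} (φ : (Fin L → Bool) → Bool) {f : Fin L → X → Bool} {d : ℕ}
    (hf : ∀ i, HasDepth enc (f i) d) : HasDepth enc (fun x => φ fun i => f i x) (d + 5 * L) := by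
  induction L with
  | zero =>
    have : (fun x => φ fun i => f i x) = fun _ => φ Fin.elim0 := by
      funext x
      exact congrArg φ (funext fun i => i.elim0)
    exact this ▸ const _ _
  | succ L ih =>
    have key (b : Bool) := ih (fun v => φ (Fin.cons b v)) (f := fun i => f i.succ)
      (fun i => hf i.succ)
    have h := ite ((hf 0).mono (Nat.le_add_right d (5 * L))) (key true) (key false)
    refine (h.mono (by omega)).congr fun x => ?_
    have hcons : (fun i => f i x) = Fin.cons (f 0 x) (fun i => f (Fin.succ i) x) := by
      funext i
      refine Fin.cases rfl (fun _ => rfl) i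
    simp only [hcons]
    cases f 0 x <;> simp

/-- A function that is determined by finitely many Boolean functions of depth `d` has depth
`d + O(1)`, where the constant depends only on their number. -/
theorem of_determined {K : Type*} [Fintype K] {f : K → X → Bool} {d : ℕ}
    (hf : ∀ k, HasDepth enc (f k) d) {g : X → Bool}
    (hg : ∀ x y, (∀ k, f k x = f k y) → g x = g y) :
    HasDepth enc g (d + 5 * Fintype.card K) := by
  classical
  let e := Fintype.equivFin K
  let φ : (Fin (Fintype.card K) → Bool) → Bool :=
    fun v => decide (∃ y, (∀ i, f (e.symm i) y = v i) ∧ g y = true)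
  have h := comp_bits φ (f := fun i => f (e.symm i)) fun i => hf _
  refine h.congr fun x => ?_
  rw [Bool.eq_iff_iff, decide_eq_true_iff]
  constructor
  · rintro ⟨y, hy, hgy⟩
    rw [← hg y x fun k => by simpa using hy (e k), hgy]
  · exact fun hx => ⟨x, fun _ => rfl, hx⟩

end HasDepth

/-! ### Counting in logarithmic depth -/

/-- Carry-save addition: three numbers are replaced by two with the same sum, each of whose bits
depends on three bits only. -/
theorem carry_save (a b c : ℕ) :
    (a ^^^ b ^^^ c) + 2 * ((a &&& b) ||| (a &&& c) ||| (b &&& c)) = a + b + c := by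
  obtain ⟨n, hn⟩ : ∃ n, a + b + c ≤ n := ⟨_, le_rfl⟩
  induction n using Nat.strong_induction_on generalizing a b c with
  | _ n ih =>
  rcases Nat.eq_zero_or_pos (a + b + c) with h0 | h0
  · obtain ⟨⟨rfl, rfl⟩, rfl⟩ : (a = 0 ∧ b = 0) ∧ c = 0 := by omega
    rfl
  · have key := ih (a / 2 + b / 2 + c / 2) (by omega) (a / 2) (b / 2) (c / 2) le_rfl
    simp only [← Nat.xor_div_two, ← Nat.and_div_two, ← Nat.or_div_two] at key
    have hs : (a ^^^ b ^^^ c) % 2 = (a + b + c) % 2 := by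
      rw [Nat.xor_mod_two_eq, Nat.add_mod, Nat.xor_mod_two_eq, ← Nat.add_mod]
    have ht : ((a &&& b) ||| (a &&& c) ||| (b &&& c)) % 2 = (a % 2 + b % 2 + c % 2) / 2 := by
      have h (m : ℕ) : m % 2 = (m.testBit 0).toNat := by
        rw [Nat.toNat_testBit, pow_zero, Nat.div_one]
      simp only [h, Nat.testBit_or, Nat.testBit_and]
      cases a.testBit 0 <;> cases b.testBit 0 <;> cases c.testBit 0 <;> rfl
    omega

/-- The bits of the numbers `a x < 2 ^ L` are computed by formulas of depth `d`. -/
structure BitsHaveDepth {ι X : Type} (enc : X → ι → Bool) (a : X → ℕ) (L d : ℕ) : Prop where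
  lt : ∀ x, a x < 2 ^ L
  bit : ∀ i, HasDepth enc (fun x => (a x).testBit i) d

namespace BitsHaveDepth

variable {ι X : Type} {enc : X → ι → Bool}

/-- One step of carry-save addition has constant depth. -/
theorem carrySave {a b c : X → ℕ} {L d : ℕ} (ha : BitsHaveDepth enc a L d)
    (hb : BitsHaveDepth enc b L d) (hc : BitsHaveDepth enc c L d) :
    ∃ s t : X → ℕ, BitsHaveDepth enc s (L + 1) (d + 15) ∧ BitsHaveDepth enc t (L + 1) (d + 15) ∧
      ∀ x, s x + t x = a x + b x + c x := by
  have three (φ : Bool → Bool → Bool → Bool) (i : ℕ) : HasDepth enc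
      (fun x => φ ((a x).testBit i) ((b x).testBit i) ((c x).testBit i)) (d + 15) :=
    HasDepth.comp_bits (L := 3) (fun v => φ (v 0) (v 1) (v 2))
      (f := ![fun x => (a x).testBit i, fun x => (b x).testBit i, fun x => (c x).testBit i])
      fun j => by
        fin_cases j
        exacts [ha.bit i, hb.bit i, hc.bit i]
  refine ⟨fun x => a x ^^^ b x ^^^ c x,
    fun x => 2 * ((a x &&& b x) ||| (a x &&& c x) ||| (b x &&& c x)),
    ⟨fun x => ?_, fun i => ?_⟩, ⟨fun x => ?_, fun i => ?_⟩, fun x => carry_save _ _ _⟩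
  · exact (Nat.xor_lt_two_pow (Nat.xor_lt_two_pow (ha.lt x) (hb.lt x)) (hc.lt x)).trans
      (Nat.pow_lt_pow_right one_lt_two L.lt_succ_self)
  · simpa only [Nat.testBit_xor] using three (fun p q r => (p ^^ q) ^^ r) i
  · rw [pow_succ']
    refine Nat.mul_lt_mul_of_pos_left ?_ two_pos
    exact Nat.or_lt_two_pow (Nat.or_lt_two_pow (Nat.and_lt_two_pow _ (hb.lt x))
      (Nat.and_lt_two_pow _ (hc.lt x))) (Nat.and_lt_two_pow _ (hc.lt x))
  · cases i with
    | zero => simpa using HasDepth.const false _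
    | succ i =>
      simpa only [Nat.testBit_succ, Nat.mul_div_cancel_left _ two_pos, Nat.testBit_or,
        Nat.testBit_and] using three (fun p q r => (p && q || p && r) || q && r) i

theorem mono {a : X → ℕ} {L L' d d' : ℕ} (ha : BitsHaveDepth enc a L d) (hL : L ≤ L')
    (hd : d ≤ d') : BitsHaveDepth enc a L' d' :=
  ⟨fun x => (ha.lt x).trans_le (Nat.pow_le_pow_right two_pos hL), fun i => (ha.bit i).mono hd⟩

end BitsHaveDepth

section Counting

variable {ι X α : Type} {enc : X → ι → Bool}

/-- A tree of carry-save adders computes the number of true values among `2 ^ k` as a sum of two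
numbers, in depth `O(k)`. -/
theorem exists_add_eq_card_filter (f : α → X → Bool) (d k : ℕ) (J : Finset α)
    (hJ : J.card ≤ 2 ^ k) (hf : ∀ j ∈ J, HasDepth enc (f j) d) :
    ∃ a b : X → ℕ, BitsHaveDepth enc a (1 + 2 * k) (d + 30 * k) ∧
      BitsHaveDepth enc b (1 + 2 * k) (d + 30 * k) ∧
      ∀ x, a x + b x = (J.filter fun j => f j x = true).card := by
  classical
  induction k generalizing J with
  | zero =>
    have zero : BitsHaveDepth enc (fun _ : X => 0) (1 + 2 * 0) (d + 30 * 0) :=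
      ⟨fun x => by norm_num, fun i => by simpa using HasDepth.const false _⟩
    rcases Nat.le_one_iff_eq_zero_or_eq_one.mp hJ with h | h
    · obtain rfl := Finset.card_eq_zero.mp h
      exact ⟨_, _, zero, zero, fun x => by simp⟩
    · obtain ⟨j, rfl⟩ := Finset.card_eq_one.mp h
      refine ⟨fun x => (f j x).toNat, _, ⟨fun x => ?_, fun i => ?_⟩, zero, fun x => ?_⟩
      · cases f j x <;> norm_num
      · cases i with
        | zero =>
          refine (hf j (by simp)).congr fun x => ?_
          cases f j x <;> rfl
        | succ i =>
          refine (HasDepth.const false _).congr fun x => ?_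
          cases f j x <;> simp [Nat.testBit_succ]
      · cases h : f j x <;> simp [Finset.filter_singleton, h]
  | succ k ih =>
    obtain ⟨J₁, hJ₁, hcard⟩ := Finset.exists_subset_card_eq
      (show min J.card (2 ^ k) ≤ J.card from min_le_left _ _)
    have hcard' : (J \ J₁).card ≤ 2 ^ k := by
      rw [Finset.card_sdiff_of_subset hJ₁, hcard]
      rw [pow_succ] at hJ
      omega
    obtain ⟨a₁, b₁, ha₁, hb₁, h₁⟩ := ih J₁ (hcard.trans_le (min_le_right _ _))
      fun j hj => hf j (hJ₁ hj)
    obtain ⟨a₂, b₂, ha₂, hb₂, h₂⟩ := ih (J \ J₁) hcard'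
      fun j hj => hf j (Finset.sdiff_subset hj)
    obtain ⟨s, t, hs, ht, hst⟩ := ha₁.carrySave hb₁ ha₂
    obtain ⟨s', t', hs', ht', hst'⟩ :=
      hs.carrySave ht (hb₂.mono (Nat.le_add_right _ 1) (Nat.le_add_right _ 15))
    refine ⟨s', t', hs'.mono (by omega) (by omega), ht'.mono (by omega) (by omega), fun x => ?_⟩
    rw [hst', hst, ← Finset.sdiff_union_of_subset hJ₁, Finset.filter_union,
      Finset.card_union_of_disjoint, ← h₁, ← h₂]
    · ring
    · exact Finset.disjoint_filter_filter Finset.sdiff_disjoint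

/-- Symmetric Boolean functions of `2 ^ k` arguments have depth `O(k)`. -/
theorem HasDepth.of_card_filter {f : α → X → Bool} {d k : ℕ} {J : Finset α}
    (hJ : J.card ≤ 2 ^ k) (hf : ∀ j ∈ J, HasDepth enc (f j) d) (φ : ℕ → Bool) :
    HasDepth enc (fun x => φ (J.filter fun j => f j x = true).card) (d + 50 * (k + 1)) := by
  obtain ⟨a, b, ha, hb, hab⟩ := exists_add_eq_card_filter f d k J hJ hf
  have h := HasDepth.of_determined (K := Fin (1 + 2 * k) ⊕ Fin (1 + 2 * k))
    (f := Sum.elim (fun i x => (a x).testBit i) (fun i x => (b x).testBit i))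
    (g := fun x => φ (J.filter fun j => f j x = true).card) (d := d + 30 * k) (enc := enc)
    (by rintro (i | i); exacts [ha.bit i, hb.bit i]) fun x y hxy => by
      have eq_of_bits {a : X → ℕ} (ha : ∀ x, a x < 2 ^ (1 + 2 * k))
          (h : ∀ i : Fin (1 + 2 * k), (a x).testBit i = (a y).testBit i) : a x = a y := by
        refine Nat.eq_of_testBit_eq fun i => ?_
        by_cases hi : i < 1 + 2 * k
        · exact h ⟨i, hi⟩
        · have hle := Nat.pow_le_pow_right two_pos (not_lt.mp hi)
          rw [Nat.testBit_lt_two_pow ((ha x).trans_le hle),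
            Nat.testBit_lt_two_pow ((ha y).trans_le hle)]
      simp only [← hab]
      rw [eq_of_bits ha.lt fun i => hxy (.inl i), eq_of_bits hb.lt fun i => hxy (.inr i)]
  refine h.mono ?_
  simp only [Fintype.card_sum, Fintype.card_fin]
  omega

end Counting

/-! ### From circuits to formulas -/

/-- Unfolding a circuit whose gates have fan-in at most `2 ^ k` into formulas increases the depth
by a factor `O(k)`. -/
theorem Circuit.hasDepth_gateValue {ι Ω X : Type} (enc : X → ι → Bool) (C : Circuit ι Ω) (k : ℕ)
    (hk : ∀ i, (C.gate i).args.card ≤ 2 ^ k) (i : Fin C.size) :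
    HasDepth enc (fun x => C.gateValue (enc x) i) (50 * (k + 1) * C.gateDepth i) := by
  induction i using WellFoundedLT.induction with
  | _ i ih =>
  set D := (C.gate i).args.sup C.gateDepth with hD
  have hargs : ∀ j ∈ (C.gate i).args,
      HasDepth enc (fun x => C.gateValue (enc x) j) (50 * (k + 1) * D) := fun j hj =>
    (ih j (C.acyclic i j hj)).mono (Nat.mul_le_mul_left _ (Finset.le_sup (f := C.gateDepth) hj))
  have key := HasDepth.of_card_filter (hk i) hargs
  have hdepth := C.gateDepth_eq i
  rw [← hD] at hdepth
  simp only [C.gateValue_eq _ i]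
  -- Every operation is a symmetric function of its arguments.
  have symm (φ : ℕ → Bool) (hc : (C.gate i).cost = 1)
      (h : ∀ x, (C.gate i).value (enc x) (C.gateValue (enc x)) =
        φ ((C.gate i).args.filter fun j => C.gateValue (enc x) j = true).card) :
      HasDepth enc (fun x => (C.gate i).value (enc x) (C.gateValue (enc x)))
        (50 * (k + 1) * C.gateDepth i) := by
    rw [hdepth, hc, mul_add_one]
    simpa only [h] using key φ
  cases hg : C.gate i with
  | input a => exact HasDepth.var a _
  | not j =>
    rw [← hg]
    refine symm (fun m => decide (m = 0)) (by rw [hg]; rfl) fun x => ?_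
    rw [hg]
    cases h : C.gateValue (enc x) j <;>
      simp [Gate.value, Gate.args, Finset.filter_singleton, h]
  | and J =>
    rw [← hg]
    refine symm (fun m => decide (m = J.card)) (by rw [hg]; rfl) fun x => ?_
    rw [hg]
    simp only [Gate.value, Gate.args, Finset.card_filter_eq_iff]
  | or J =>
    rw [← hg]
    refine symm (fun m => decide (0 < m)) (by rw [hg]; rfl) fun x => ?_
    rw [hg]
    simp only [Gate.value, Gate.args, Finset.card_pos, Finset.filter_nonempty_iff]
  | maj J =>
    rw [← hg]
    refine symm (fun m => decide (J.card ≤ 2 * m)) (by rw [hg]; rfl) fun x => ?_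
    rw [hg]
    rfl

/-! ### From formulas to circuits -/

/-- The values of the gates are the only solution of the equations of a circuit. -/
theorem Circuit.gateValue_unique {ι Ω : Type} (C : Circuit ι Ω) (x : ι → Bool)
    (v : Fin C.size → Bool) (hv : ∀ i, v i = (C.gate i).value x v) (i : Fin C.size) :
    C.gateValue x i = v i := by
  induction i using WellFoundedLT.induction with
  | _ i ih =>
  have ih' : ∀ j ∈ (C.gate i).args, C.gateValue x j = v j := fun j hj => ih j (C.acyclic i j hj)
  rw [C.gateValue_eq, hv]
  cases hg : C.gate i with
  | input a => rfl
  | not j => simp [Gate.value, ih' j (by simp [hg, Gate.args])]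
  | and J =>
    simp only [hg, Gate.args] at ih'
    simp only [Gate.value]
    exact decide_eq_decide.mpr (forall₂_congr fun j hj => by rw [ih' j hj])
  | or J =>
    simp only [hg, Gate.args] at ih'
    simp only [Gate.value]
    exact decide_eq_decide.mpr (exists_congr fun j => and_congr_right fun hj => by rw [ih' j hj])
  | maj J =>
    simp only [hg, Gate.args] at ih'
    simp only [Gate.value]
    rw [Finset.filter_congr fun j hj => by rw [ih' j hj]]

/-- A bound on the depth of the gates may be checked gate by gate. -/
theorem Circuit.gateDepth_le {ι Ω : Type} (C : Circuit ι Ω) (d : Fin C.size → ℕ)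
    (hcost : ∀ i, (C.gate i).cost ≤ d i)
    (hd : ∀ i, ∀ j ∈ (C.gate i).args, d j + (C.gate i).cost ≤ d i) (i : Fin C.size) :
    C.gateDepth i ≤ d i := by
  induction i using WellFoundedLT.induction with
  | _ i ih =>
  rw [C.gateDepth_eq, ← Nat.le_sub_iff_add_le (hcost i)]
  exact Finset.sup_le fun j hj =>
    (ih j (C.acyclic i j hj)).trans (Nat.le_sub_of_add_le (hd i j hj))

/-- A finite type can be enumerated in an order that refines a given rank. -/
theorem exists_equiv_fin_of_rank {α : Type*} [Fintype α] (r : α → ℕ) :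
    ∃ e : α ≃ Fin (Fintype.card α), ∀ a b, r a < r b → e a < e b := by
  let e₀ := Fintype.equivFin α
  refine ⟨e₀.trans (Tuple.sort (r ∘ e₀.symm)).symm, fun a b hab => ?_⟩
  by_contra! h
  have := Tuple.monotone_sort (r ∘ e₀.symm) h
  simp at this
  omega

namespace Formula

variable {ι : Type}

/-- The gate for the outermost operation of a formula, when the gates for the subformulas are
numbered by `idx`. -/
def toGate {s : ℕ} (idx : Formula ι → Fin s) : Formula ι → Gate ι s
  | const true => .and ∅
  | const false => .or ∅
  | var i => .input i
  | not F => .not (idx F)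
  | and F G => .and {idx F, idx G}

theorem isBoolean_toGate {s : ℕ} (idx : Formula ι → Fin s) (F : Formula ι) :
    (F.toGate idx).IsBoolean := by
  cases F with
  | const b => cases b <;> trivial
  | _ => trivial

theorem cost_toGate_le {s : ℕ} (idx : Formula ι → Fin s) (F : Formula ι) :
    (F.toGate idx).cost ≤ 1 := by
  cases F with
  | const b => cases b <;> simp [toGate, Gate.cost]
  | _ => simp [toGate, Gate.cost]

variable [DecidableEq (Formula ι)]

/-- The set of subformulas of a formula. -/
def subformulas : Formula ι → Finset (Formula ι)
  | const b => {const b}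
  | var i => {var i}
  | not F => insert (not F) F.subformulas
  | and F G => insert (and F G) (F.subformulas ∪ G.subformulas)

theorem self_mem_subformulas (F : Formula ι) : F ∈ F.subformulas := by
  cases F <;> simp [subformulas]

theorem card_subformulas_lt (F : Formula ι) : F.subformulas.card < 2 ^ (F.depth + 1) := by
  induction F with
  | const b => simp [subformulas, depth]
  | var i => simp [subformulas, depth]
  | not F ih =>
    have := Finset.card_insert_le (not F) F.subformulas
    simp only [subformulas, depth]
    rw [pow_succ]
    omega
  | and F G ihF ihG =>
    have h₁ := Finset.card_insert_le (and F G) (F.subformulas ∪ G.subformulas)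
    have h₂ := Finset.card_union_le F.subformulas G.subformulas
    have hF : 2 ^ (F.depth + 1) ≤ 2 ^ (max F.depth G.depth + 1) :=
      Nat.pow_le_pow_right two_pos (by omega)
    have hG : 2 ^ (G.depth + 1) ≤ 2 ^ (max F.depth G.depth + 1) :=
      Nat.pow_le_pow_right two_pos (by omega)
    simp only [subformulas, depth]
    rw [pow_succ _ (max F.depth G.depth + 1)]
    omega

theorem depth_le_of_mem_subformulas {F G : Formula ι} (h : F ∈ G.subformulas) :
    F.depth ≤ G.depth := by
  induction G with
  | const b => simp [Finset.mem_singleton.mp h]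
  | var i => simp [Finset.mem_singleton.mp h]
  | not G ih =>
    rcases Finset.mem_insert.mp h with rfl | h
    exacts [le_rfl, (ih h).trans (Nat.le_succ _)]
  | and G G' ih ih' =>
    rcases Finset.mem_insert.mp h with rfl | h
    · exact le_rfl
    · simp only [depth]
      rcases Finset.mem_union.mp h with h | h
      · have := ih h
        omega
      · have := ih' h
        omega

/-- The immediate subformulas of a formula. -/
def children : Formula ι → Finset (Formula ι)
  | const _ => ∅
  | var _ => ∅
  | not F => {F}
  | and F G => {F, G}

theorem depth_lt_of_mem_children {F G : Formula ι} (h : F ∈ G.children) : F.depth < G.depth := by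
  cases G with
  | const b => simp [children] at h
  | var i => simp [children] at h
  | not G => simp_all [children, depth]
  | and G G' =>
    simp only [children, Finset.mem_insert, Finset.mem_singleton] at h
    simp only [depth]
    rcases h with rfl | rfl <;> omega

theorem mem_subformulas_of_mem_children {F G H : Formula ι} (hG : G ∈ H.subformulas)
    (hF : F ∈ G.children) : F ∈ H.subformulas := by
  have self (G : Formula ι) (hF : F ∈ G.children) : F ∈ G.subformulas := by
    cases G with
    | const b => simp [children] at hF
    | var i => simp [children] at hF
    | not G =>
      obtain rfl := Finset.mem_singleton.mp hF
      exact Finset.mem_insert_of_mem F.self_mem_subformulas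
    | and G G' =>
      simp only [children, Finset.mem_insert, Finset.mem_singleton] at hF
      refine Finset.mem_insert_of_mem (Finset.mem_union.mpr ?_)
      rcases hF with rfl | rfl
      exacts [.inl (self_mem_subformulas _), .inr (self_mem_subformulas _)]
  induction H with
  | const b => exact self _ (Finset.mem_singleton.mp hG ▸ hF)
  | var i => exact self _ (Finset.mem_singleton.mp hG ▸ hF)
  | not H ih =>
    rcases Finset.mem_insert.mp hG with rfl | h
    exacts [self _ hF, Finset.mem_insert_of_mem (ih h)]
  | and H H' ih ih' =>
    rcases Finset.mem_insert.mp hG with rfl | h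
    · exact self _ hF
    · refine Finset.mem_insert_of_mem (Finset.mem_union.mpr ?_)
      exact (Finset.mem_union.mp h).imp ih ih'

theorem args_toGate {s : ℕ} (idx : Formula ι → Fin s) (F : Formula ι) :
    (F.toGate idx).args = F.children.image idx := by
  cases F with
  | const b => cases b <;> rfl
  | var i => rfl
  | not F => simp [toGate, Gate.args, children]
  | and F G => simp [toGate, Gate.args, children, Finset.image_insert]

theorem card_args_toGate_le {s : ℕ} (idx : Formula ι → Fin s) (F : Formula ι) :
    (F.toGate idx).args.card ≤ 2 := by
  rw [args_toGate]
  refine Finset.card_image_le.trans ?_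
  cases F <;> simp [children, Finset.card_le_two]

theorem value_toGate {s : ℕ} (idx : Formula ι → Fin s) (x : ι → Bool) (v : Fin s → Bool)
    (F : Formula ι) (hv : ∀ G ∈ F.children, v (idx G) = G.eval x) :
    (F.toGate idx).value x v = F.eval x := by
  cases F with
  | const b => cases b <;> simp [toGate, Gate.value, eval]
  | var i => rfl
  | not F => simp [toGate, Gate.value, eval, hv F (by simp [children])]
  | and F G =>
    simp [toGate, Gate.value, eval, hv F (by simp [children]), hv G (by simp [children])]

end Formula

/-- Finitely many formulas of depth at most `d` form a circuit of fan-in two, whose gates are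
their subformulas, ordered by depth. -/
theorem Circuit.exists_of_hasDepth {ι X Ω : Type} [Fintype Ω] {enc : X → ι → Bool}
    {g : Ω → X → Bool} {d : ℕ} (hg : ∀ o, HasDepth enc (g o) d) :
    ∃ C : Circuit ι Ω, C.size ≤ Fintype.card Ω * 2 ^ (d + 1) ∧ C.depth ≤ d + 1 ∧
      (∀ i, (C.gate i).IsBoolean ∧ (C.gate i).args.card ≤ 2) ∧
      ∀ x o, C.eval (enc x) o = g o x := by
  classical
  choose F hF hFg using hg
  let S : Finset (Formula ι) := Finset.univ.biUnion fun o => (F o).subformulas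
  have hS {G H : Formula ι} (hG : G ∈ S) (hH : H ∈ G.children) : H ∈ S := by
    obtain ⟨o, ho, hG⟩ := Finset.mem_biUnion.mp hG
    exact Finset.mem_biUnion.mpr ⟨o, ho, Formula.mem_subformulas_of_mem_children hG hH⟩
  obtain ⟨e, he⟩ := exists_equiv_fin_of_rank fun G : S => G.1.depth
  -- The fallback value is never used, since `S` is closed under subformulas.
  let idx (i : Fin (Fintype.card S)) (G : Formula ι) := if h : G ∈ S then e ⟨G, h⟩ else i
  have hidx (i) {G : Formula ι} (h : G ∈ S) : idx i G = e ⟨G, h⟩ := dif_pos h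
  have hargs (i j) (hj : j ∈ ((e.symm i).1.toGate (idx i)).args) :
      (e.symm j).1 ∈ (e.symm i).1.children := by
    rw [Formula.args_toGate, Finset.mem_image] at hj
    obtain ⟨G, hG, rfl⟩ := hj
    rwa [hidx i (hS (e.symm i).2 hG), Equiv.symm_apply_apply]
  let C : Circuit ι Ω :=
    { size := Fintype.card S
      gate := fun i => (e.symm i).1.toGate (idx i)
      acyclic := fun i j hj => by
        simpa using he _ _ (Formula.depth_lt_of_mem_children (hargs i j hj))
      out := fun o => e ⟨F o, Finset.mem_biUnion.mpr
        ⟨o, Finset.mem_univ o, (F o).self_mem_subformulas⟩⟩ }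
  refine ⟨C, ?_, ?_, fun i => ⟨Formula.isBoolean_toGate _ _, Formula.card_args_toGate_le _ _⟩,
    fun x o => ?_⟩
  · change Fintype.card S ≤ _
    rw [Fintype.card_coe, ← Finset.card_univ (α := Ω)]
    exact Finset.card_biUnion_le_card_mul _ _ _ fun o _ =>
      (Formula.card_subformulas_lt _).le.trans (Nat.pow_le_pow_right two_pos (by gcongr; exact hF o))
  · refine Finset.sup_le fun i _ => ?_
    refine (C.gateDepth_le (fun i => (e.symm i).1.depth + 1) (fun i => ?_)
      (fun i j hj => ?_) i).trans ?_
    · exact (Formula.cost_toGate_le _ _).trans (Nat.le_add_left _ _)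
    · exact Nat.add_le_add (Formula.depth_lt_of_mem_children (hargs i j hj))
        (Formula.cost_toGate_le _ _)
    · obtain ⟨o, -, ho⟩ := Finset.mem_biUnion.mp (e.symm i).2
      exact Nat.succ_le_succ ((Formula.depth_le_of_mem_subformulas ho).trans (hF o))
  · refine (C.gateValue_unique (enc x) (fun i => (e.symm i).1.eval (enc x)) (fun i => ?_)
      (C.out o)).trans ?_
    · refine (Formula.value_toGate _ _ _ _ fun G hG => ?_).symm
      rw [hidx i (hS (e.symm i).2 hG), Equiv.symm_apply_apply]
    · change (e.symm (e _)).1.eval _ = _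
      rw [Equiv.symm_apply_apply]
      exact hFg o x

/-! ### Polynomial size and logarithmic depth -/

theorem _root_.Polynomial.eval_le_eval_of_le (p : Polynomial ℕ) {m n : ℕ} (h : m ≤ n) :
    p.eval m ≤ p.eval n := by
  rw [Polynomial.eval_eq_sum, Polynomial.eval_eq_sum]
  exact Finset.sum_le_sum fun i _ => Nat.mul_le_mul_left _ (Nat.pow_le_pow_left h i)

/-- Polynomial growth is growth as `2 ^ O(log n)`. -/
theorem polyBounded_iff {s : ℕ → ℕ} :
    PolyBounded s ↔ ∃ c, ∀ n, s n ≤ 2 ^ (c * (Nat.log 2 n + 1)) := by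
  constructor
  · rintro ⟨p, hp⟩
    refine ⟨p.eval 1 + p.natDegree, fun n => ?_⟩
    set l := Nat.log 2 n + 1 with hl
    calc s n ≤ p.eval (2 ^ l) :=
          (hp n).trans (p.eval_le_eval_of_le (Nat.lt_pow_succ_log_self one_lt_two n).le)
      _ ≤ p.eval 1 * (2 ^ l) ^ p.natDegree := by
          rw [Polynomial.eval_eq_sum, Polynomial.eval_eq_sum, Polynomial.sum, Polynomial.sum,
            Finset.sum_mul]
          refine Finset.sum_le_sum fun i hi => ?_
          rw [one_pow, mul_one]
          exact Nat.mul_le_mul_left _ (Nat.pow_le_pow_right (by positivity)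
            (Polynomial.le_natDegree_of_mem_supp i hi))
      _ ≤ 2 ^ (p.eval 1 * l) * 2 ^ (p.natDegree * l) := by
          rw [← pow_mul, mul_comm l]
          gcongr
          exact Nat.lt_two_pow_self.le.trans (Nat.pow_le_pow_right two_pos
            (Nat.le_mul_of_pos_right _ (Nat.succ_pos _)))
      _ = _ := by rw [← pow_add, add_mul]
  · rintro ⟨c, hc⟩
    refine ⟨Polynomial.C (2 ^ c) * (Polynomial.X + 1) ^ c, fun n => (hc n).trans ?_⟩
    simp only [Polynomial.eval_mul, Polynomial.eval_C, Polynomial.eval_pow, Polynomial.eval_add,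
      Polynomial.eval_X, Polynomial.eval_one]
    rw [mul_add_one, pow_add, mul_comm, mul_comm c, pow_mul]
    gcongr
    rcases Nat.eq_zero_or_pos n with rfl | h
    · simp
    · exact (Nat.pow_log_le_self 2 h.ne').trans (Nat.le_succ n)

theorem PolyBounded.mono {s t : ℕ → ℕ} (ht : PolyBounded t) (h : ∀ n, s n ≤ t n) :
    PolyBounded s :=
  let ⟨p, hp⟩ := ht
  ⟨p, fun n => (h n).trans (hp n)⟩

theorem PolyBounded.add {s t : ℕ → ℕ} (hs : PolyBounded s) (ht : PolyBounded t) :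
    PolyBounded fun n => s n + t n :=
  let ⟨p, hp⟩ := hs
  let ⟨q, hq⟩ := ht
  ⟨p + q, fun n => by simpa using Nat.add_le_add (hp n) (hq n)⟩

theorem PolyBounded.const_mul {s : ℕ → ℕ} (c : ℕ) (hs : PolyBounded s) :
    PolyBounded fun n => c * s n :=
  let ⟨p, hp⟩ := hs
  ⟨Polynomial.C c * p, fun n => by simpa using Nat.mul_le_mul_left c (hp n)⟩

theorem PolyBounded.comp {s t : ℕ → ℕ} (hs : PolyBounded s) (ht : PolyBounded t) :
    PolyBounded fun n => s (t n) :=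
  let ⟨p, hp⟩ := hs
  let ⟨q, hq⟩ := ht
  ⟨p.comp q, fun n => by
    rw [Polynomial.eval_comp]
    exact (hp _).trans (p.eval_le_eval_of_le (hq n))⟩

open Classical in
/-- The characteristic function of the words of length `n` of a problem. -/
noncomputable def DecisionProblem.indicator (P : DecisionProblem) (n : ℕ)
    (w : Fin n → P.alphabet) : Bool :=
  decide (List.ofFn w ∈ P.language)

theorem DecisionProblem.indicator_eq_true_iff (P : DecisionProblem) (n : ℕ)
    (w : Fin n → P.alphabet) : P.indicator n w = true ↔ List.ofFn w ∈ P.language := by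
  classical
  exact decide_eq_true_iff

/-- The problem is decided by formulas of logarithmic depth. -/
def HasLogDepthFormulas (P : DecisionProblem) : Prop :=
  ∃ c, ∀ n, HasDepth letters (P.indicator n) (c * (Nat.log 2 n + 1))

/-- Formulas of logarithmic depth have polynomial size. -/
theorem HasLogDepthFormulas.mem_NC1 {P : DecisionProblem} (h : HasLogDepthFormulas P) :
    P ∈ NC1 := by
  obtain ⟨c, hc⟩ := h
  choose C hsize hdepth hgate heval using fun n =>
    Circuit.exists_of_hasDepth (Ω := Unit) fun _ => hc n
  refine ⟨C, fun n w => ?_, polyBounded_iff.mpr ⟨c + 1, fun n => (hsize n).trans ?_⟩,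
    ⟨c + 1, fun n => (hdepth n).trans ?_⟩, hgate⟩
  · rw [heval, DecisionProblem.indicator_eq_true_iff]
  · rw [Fintype.card_unit, one_mul]
    exact Nat.pow_le_pow_right two_pos (by nlinarith)
  · nlinarith

/-- Circuits with fan-in `2 ^ k` and depth `d`, where `k * d` is logarithmic, unfold into formulas
of logarithmic depth. -/
theorem HasLogDepthFormulas.of_circuits {P : DecisionProblem}
    {C : ∀ n, Circuit (Fin n × P.alphabet) Unit} (hC : Decides P C) (k : ℕ → ℕ) (c : ℕ)
    (hk : ∀ n i, ((C n).gate i).args.card ≤ 2 ^ k n)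
    (hc : ∀ n, (k n + 1) * (C n).depth ≤ c * (Nat.log 2 n + 1)) : HasLogDepthFormulas P := by
  refine ⟨50 * c, fun n => ?_⟩
  refine (((C n).hasDepth_gateValue letters (k n) (hk n) ((C n).out ())).mono ?_).congr fun w => ?_
  · have : (C n).gateDepth ((C n).out ()) ≤ (C n).depth :=
      Finset.le_sup (f := (C n).gateDepth) (Finset.mem_univ _)
    calc _ ≤ 50 * (k n + 1) * (C n).depth := Nat.mul_le_mul_left _ this
      _ ≤ _ := by
        rw [mul_assoc, mul_assoc]
        exact Nat.mul_le_mul_left _ (hc n)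
  · rw [Bool.eq_iff_iff, DecisionProblem.indicator_eq_true_iff]
    exact hC n w

theorem hasLogDepthFormulas_of_mem_NC1 {P : DecisionProblem} (h : P ∈ NC1) :
    HasLogDepthFormulas P := by
  obtain ⟨C, hC, -, ⟨d, hd⟩, hgate⟩ := h
  refine .of_circuits hC (fun _ => 1) (2 * d) (fun n i => (hgate n i).2) fun n => ?_
  rw [mul_assoc]
  exact Nat.mul_le_mul_left 2 (hd n)

theorem TC0_subset_NC1 : TC0 ⊆ NC1 := by
  rintro P ⟨C, hC, hsize, d, hd⟩
  obtain ⟨c, hc⟩ := polyBounded_iff.mp hsize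
  refine (HasLogDepthFormulas.of_circuits hC (fun n => c * (Nat.log 2 n + 1)) ((c + 1) * d)
    (fun n i => ?_) fun n => ?_).mem_NC1
  · exact (Finset.card_le_univ _).trans ((Fintype.card_fin _).trans_le (hc n))
  · calc _ ≤ ((c + 1) * (Nat.log 2 n + 1)) * d := Nat.mul_le_mul (by nlinarith) (hd n)
      _ = _ := by ring

/-! ### Closure of `TC⁰` under `AC⁰` reductions -/

namespace Gate

variable {ι κ : Type} {s t : ℕ}

/-- Embedding of a gate into a circuit with more gates, in front of which `s` gates of another
circuit are inserted. Its input variables are the outputs `o` of the other circuit; they become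
conjunctions of fan-in one. -/
def shift (o : κ → Fin s) : Gate κ t → Gate ι (s + t)
  | input k => and {Fin.castAdd t (o k)}
  | not j => not (Fin.natAdd s j)
  | and J => and (J.map (Fin.natAddEmb s))
  | or J => or (J.map (Fin.natAddEmb s))
  | maj J => maj (J.map (Fin.natAddEmb s))

/-- Embedding of a gate into a circuit to which `t` gates are appended. -/
def extend (t : ℕ) : Gate ι s → Gate ι (s + t)
  | input i => input i
  | not j => not (Fin.castAdd t j)
  | and J => and (J.map (Fin.castAddEmb t))
  | or J => or (J.map (Fin.castAddEmb t))
  | maj J => maj (J.map (Fin.castAddEmb t))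

theorem args_extend (g : Gate ι s) : (g.extend t).args = g.args.map (Fin.castAddEmb t) := by
  cases g <;> simp [extend, args]

theorem cost_extend (g : Gate ι s) : (g.extend t).cost = g.cost := by
  cases g <;> rfl

theorem value_extend (g : Gate ι s) (x : ι → Bool) (v : Fin (s + t) → Bool) :
    (g.extend t).value x v = g.value x fun j => v (Fin.castAdd t j) := by
  cases g with
  | input i => rfl
  | not j => rfl
  | and J => simp [extend, value]
  | or J => simp [extend, value]
  | maj J =>
    simp only [extend, value, Finset.filter_map, Finset.card_map]
    rfl

theorem mem_args_shift {o : κ → Fin s} {g : Gate κ t} {j : Fin (s + t)}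
    (hj : j ∈ (g.shift (ι := ι) o).args) :
    (∃ k, g = input k ∧ j = Fin.castAdd t (o k)) ∨ ∃ i ∈ g.args, j = Fin.natAdd s i := by
  cases g with
  | input k => exact .inl ⟨k, rfl, Finset.mem_singleton.mp hj⟩
  | not i => exact .inr ⟨i, Finset.mem_singleton_self i, Finset.mem_singleton.mp hj⟩
  | and J | or J | maj J =>
    obtain ⟨i, hi, rfl⟩ := Finset.mem_map.mp hj
    exact .inr ⟨i, hi, rfl⟩

theorem value_shift (o : κ → Fin s) (g : Gate κ t) (x : ι → Bool) (v : Fin (s + t) → Bool) :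
    (g.shift o).value x v =
      g.value (fun k => v (Fin.castAdd t (o k))) fun j => v (Fin.natAdd s j) := by
  cases g with
  | input i => simp [shift, value]
  | not j => rfl
  | and J => simp [shift, value]
  | or J => simp [shift, value]
  | maj J =>
    simp only [shift, value, Finset.filter_map, Finset.card_map]
    rfl

end Gate

/-- Composition of circuits: the outputs of the first are the inputs of the second. -/
def Circuit.comp {ι κ Ω : Type} (C : Circuit ι κ) (C' : Circuit κ Ω) : Circuit ι Ω where
  size := C.size + C'.size
  gate := Fin.addCases (fun i => (C.gate i).extend C'.size) fun i => (C'.gate i).shift C.out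
  acyclic i := by
    refine Fin.addCases (fun i j hj => ?_) (fun i j hj => ?_) i
    · rw [Fin.addCases_left, Gate.args_extend] at hj
      obtain ⟨j', hj', rfl⟩ := Finset.mem_map.mp hj
      exact C.acyclic i j' hj'
    · rw [Fin.addCases_right] at hj
      rcases Gate.mem_args_shift hj with ⟨k, -, rfl⟩ | ⟨j', hj', rfl⟩
      · exact Fin.lt_def.mpr ((C.out k).isLt.trans_le (Nat.le_add_right _ _))
      · simpa using C'.acyclic i j' hj'
  out o := Fin.natAdd C.size (C'.out o)

theorem Circuit.eval_comp {ι κ Ω : Type} (C : Circuit ι κ) (C' : Circuit κ Ω) (x : ι → Bool) :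
    (C.comp C').eval x = C'.eval (C.eval x) := by
  funext o
  refine ((C.comp C').gateValue_unique x
    (Fin.addCases (C.gateValue x) (C'.gateValue (C.eval x))) (fun i => ?_) _).trans
    (Fin.addCases_right _)
  refine Fin.addCases (fun i => ?_) (fun i => ?_) i
  · simp only [comp, Fin.addCases_left, Gate.value_extend]
    exact C.gateValue_eq x i
  · simp only [comp, Fin.addCases_right, Fin.addCases_left, Gate.value_shift]
    exact C'.gateValue_eq _ i

theorem Circuit.depth_comp_le {ι κ Ω : Type} (C : Circuit ι κ) (C' : Circuit κ Ω) :
    (C.comp C').depth ≤ C.depth + C'.depth + 1 := by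
  have hC (i) : C.gateDepth i ≤ C.depth := Finset.le_sup (f := C.gateDepth) (Finset.mem_univ i)
  have hC' (i) : C'.gateDepth i ≤ C'.depth :=
    Finset.le_sup (f := C'.gateDepth) (Finset.mem_univ i)
  refine Finset.sup_le fun i _ => ?_
  refine ((C.comp C').gateDepth_le
    (Fin.addCases C.gateDepth fun i => C.depth + 1 + C'.gateDepth i) (fun i => ?_)
    (fun i => ?_) i).trans ?_
  · refine Fin.addCases (fun i => ?_) (fun i => ?_) i
    · simp only [comp, Fin.addCases_left, Gate.cost_extend]
      rw [C.gateDepth_eq]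
      exact Nat.le_add_left _ _
    · simp only [comp, Fin.addCases_right]
      have : ((C'.gate i).shift (ι := ι) C.out).cost ≤ 1 := by
        cases C'.gate i <;> simp [Gate.shift, Gate.cost]
      omega
  · refine Fin.addCases (fun i j hj => ?_) (fun i j hj => ?_) i
    · simp only [comp, Fin.addCases_left, Gate.cost_extend, Gate.args_extend] at hj ⊢
      obtain ⟨j', hj', rfl⟩ := Finset.mem_map.mp hj
      have h : (Fin.addCases C.gateDepth (fun i => C.depth + 1 + C'.gateDepth i)
        (Fin.castAdd C'.size j') : ℕ) = C.gateDepth j' := Fin.addCases_left j'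
      have hle := Finset.le_sup (f := C.gateDepth) hj'
      rw [C.gateDepth_eq i]
      exact Nat.add_le_add_right (h.trans_le hle) _
    · simp only [comp, Fin.addCases_right] at hj ⊢
      rcases Gate.mem_args_shift hj with ⟨k, hg, rfl⟩ | ⟨j', hj', rfl⟩
      · have := hC (C.out k)
        rw [Fin.addCases_left, hg]
        simp only [Gate.shift, Gate.cost]
        omega
      · have hle := Finset.le_sup (f := C'.gateDepth) hj'
        have hcost : ((C'.gate i).shift (ι := ι) C.out).cost = (C'.gate i).cost := by
          cases hg : C'.gate i with
          | input k => simp [hg, Gate.args] at hj'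
          | _ => rfl
        rw [Fin.addCases_right, hcost, C'.gateDepth_eq i]
        omega
  · refine Fin.addCases (fun i => ?_) (fun i => ?_) i
    · rw [Fin.addCases_left]
      have := hC i
      omega
    · rw [Fin.addCases_right]
      have := hC' i
      omega

theorem AC0Reduces.mem_TC0 {P Q : DecisionProblem} (h : AC0Reduces P Q) (hQ : Q ∈ TC0) :
    P ∈ TC0 := by
  obtain ⟨l, f, C, hl, hsize, ⟨d, hd⟩, -, heval, hf⟩ := h
  obtain ⟨C', hC', hsize', d', hd'⟩ := hQ
  refine ⟨fun n => (C n).comp (C' (l n)), fun n w => ?_, hsize.add (hsize'.comp hl),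
    d + d' + 1, fun n => ?_⟩
  · rw [Circuit.eval_comp, heval, hf]
    exact hC' _ _
  · refine ((C n).depth_comp_le (C' (l n))).trans ?_
    have := hd n
    have := hd' (l n)
    omega

/-! ### Swap tracking is in `NC¹` -/

/-- The composition of `2 ^ k` swaps is computed in depth `O(k)`, by divide and conquer: it is
determined by the compositions of the two halves, which are elements of a finite group. -/
theorem hasDepth_prod_perm {n : ℕ} (k : ℕ) (l : List (Fin n)) (hl : l.length ≤ 2 ^ k)
    (σ : Equiv.Perm (Fin 5)) :
    HasDepth (letters (A := Swap)) (fun w => decide ((l.map fun i => (w i).perm).prod = σ))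
      (5 * Fintype.card Swap + 5 * Fintype.card (Bool × Equiv.Perm (Fin 5)) * k) := by
  induction k generalizing l σ with
  | zero =>
    match l with
    | [] => exact HasDepth.const (decide (1 = σ)) _
    | [i] =>
      refine (HasDepth.of_determined (fun s => HasDepth.var (i, s) 0) fun v w h => ?_).mono
        (by omega)
      have hvw : v i = w i := by
        have := h (w i)
        simpa [letters] using this
      simp [hvw]
    | _ :: _ :: _ => simp at hl
  | succ k ih =>
    have h₁ := ih (l.take (2 ^ k)) (by simp)
    have h₂ := ih (l.drop (2 ^ k)) (by rw [pow_succ] at hl; simp; omega)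
    refine (HasDepth.of_determined (K := Bool × Equiv.Perm (Fin 5))
      (f := fun p w => bif p.1 then
        decide (((l.take (2 ^ k)).map fun i => (w i).perm).prod = p.2) else
        decide (((l.drop (2 ^ k)).map fun i => (w i).perm).prod = p.2))
      (by rintro ⟨_ | _, τ⟩; exacts [h₂ τ, h₁ τ]) fun v w h => ?_).mono (by
        rw [mul_add_one]
        omega)
    have e₁ := h (true, ((l.take (2 ^ k)).map fun i => (w i).perm).prod)
    have e₂ := h (false, ((l.drop (2 ^ k)).map fun i => (w i).perm).prod)
    simp only [cond_true, cond_false, decide_true, decide_eq_true_eq] at e₁ e₂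
    have halves (w : Fin n → Swap) : (l.map fun i => (w i).perm).prod =
        ((l.take (2 ^ k)).map fun i => (w i).perm).prod *
          ((l.drop (2 ^ k)).map fun i => (w i).perm).prod := by
      rw [← List.prod_append, ← List.map_append, List.take_append_drop]
    rw [halves v, halves w, e₁, e₂]

theorem swapTracking_mem_NC1 : swapTracking ∈ NC1 := by
  refine HasLogDepthFormulas.mem_NC1
    ⟨5 * Fintype.card Swap + 5 * Fintype.card (Bool × Equiv.Perm (Fin 5)), fun n => ?_⟩
  refine ((hasDepth_prod_perm (Nat.log 2 n + 1) (List.finRange n) ?_ 1).mono ?_).congr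
    fun w => ?_
  · rw [List.length_finRange]
    exact (Nat.lt_pow_succ_log_self one_lt_two n).le
  · rw [add_mul]
    exact Nat.add_le_add_right (Nat.le_mul_of_pos_right _ (Nat.succ_pos _)) _
  · refine Bool.eq_iff_iff.mpr (decide_eq_true_iff.trans (Iff.trans ?_
      (swapTracking.indicator_eq_true_iff n w).symm))
    change _ ↔ ((List.ofFn w).map Swap.perm).prod = 1
    rw [List.map_ofFn, List.ofFn_eq_map]
    rfl

/-! ### Barrington's theorem -/

/-- An instruction of a program over swaps. It emits its first swap if it tests no variable or a
variable that is true, and its second swap if it tests a variable that is false. -/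
abbrev Instruction (ι : Type) : Type := Option ι × Swap × Swap

/-- The swap that an instruction emits. -/
def Instruction.emit {ι : Type} (x : ι → Bool) (a : Instruction ι) : Swap :=
  if a.1.elim true x then a.2.1 else a.2.2

/-- The composition of the swaps that a program emits. -/
def runProgram {ι : Type} (x : ι → Bool) (p : List (Instruction ι)) : Equiv.Perm (Fin 5) :=
  (p.map fun a => (a.emit x).perm).prod

theorem runProgram_append {ι : Type} (x : ι → Bool) (p q : List (Instruction ι)) :
    runProgram x (p ++ q) = runProgram x p * runProgram x q := by
  simp [runProgram]

/-- The 3-cycle `x ↦ y ↦ z ↦ x`, for distinct `x`, `y` and `z`. -/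
def threeCycle (x y z : Fin 5) : Equiv.Perm (Fin 5) := Equiv.swap x y * Equiv.swap y z

theorem threeCycle_mul_reverse (x y z : Fin 5) : threeCycle z y x * threeCycle x y z = 1 := by
  simp [threeCycle, Equiv.swap_comm z y, Equiv.swap_comm y x, mul_assoc]

/-- Every 3-cycle is a commutator of two 3-cycles: with the remaining elements `u` and `v`,
`(x y z)` is the commutator of `(x u z)` and `(z y v)`. -/
theorem threeCycle_eq_commutator : ∀ x y z : Fin 5, x ≠ y → y ≠ z → x ≠ z →
    ∃ u v, (x ≠ u ∧ u ≠ z) ∧ (y ≠ v ∧ z ≠ v) ∧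
      threeCycle x u z * threeCycle z y v * threeCycle z u x * threeCycle v y z =
        threeCycle x y z := by
  unfold threeCycle
  decide

theorem exists_perm_eq_swap {x y : Fin 5} (h : x ≠ y) : ∃ s : Swap, s.perm = Equiv.swap x y := by
  rcases h.lt_or_gt with h | h
  · exact ⟨⟨(x, y), h⟩, rfl⟩
  · exact ⟨⟨(y, x), h⟩, Equiv.swap_comm _ _⟩

/-- Barrington's theorem: a formula of depth `d` is simulated by a program of length `O(4 ^ d)`,
which composes to a given 3-cycle if the formula is true and to the identity otherwise. A
conjunction becomes a commutator. -/
theorem exists_program {ι : Type} (F : Formula ι) {x y z : Fin 5} (hxy : x ≠ y) (hyz : y ≠ z)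
    (hxz : x ≠ z) : ∃ p : List (Instruction ι), p.length ≤ 2 * 4 ^ F.depth ∧
      ∀ v, runProgram v p = if F.eval v then threeCycle x y z else 1 := by
  induction F generalizing x y z with
  | const b =>
    obtain ⟨s, hs⟩ := exists_perm_eq_swap hxy
    obtain ⟨t, ht⟩ := exists_perm_eq_swap hyz
    cases b
    · exact ⟨[], by simp, fun v => by simp [runProgram, Formula.eval]⟩
    · exact ⟨[(none, s, s), (none, t, t)], by simp [Formula.depth],
        fun v => by simp [runProgram, Instruction.emit, Formula.eval, threeCycle, hs, ht]⟩
  | var i =>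
    obtain ⟨s, hs⟩ := exists_perm_eq_swap hxy
    obtain ⟨t, ht⟩ := exists_perm_eq_swap hyz
    refine ⟨[(none, s, s), (some i, t, s)], by simp [Formula.depth], fun v => ?_⟩
    cases h : v i <;> simp [runProgram, Instruction.emit, Formula.eval, threeCycle, hs, ht, h]
  | not F ih =>
    obtain ⟨p, hp, hpF⟩ := ih hyz.symm hxy.symm hxz.symm
    obtain ⟨s, hs⟩ := exists_perm_eq_swap hxy
    obtain ⟨t, ht⟩ := exists_perm_eq_swap hyz
    refine ⟨p ++ [(none, s, s), (none, t, t)], ?_, fun v => ?_⟩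
    · have : 0 < 4 ^ F.depth := by positivity
      simp only [List.length_append, List.length_cons, List.length_nil, Formula.depth, pow_succ]
      omega
    · have : runProgram v [(none, s, s), (none, t, t)] = threeCycle x y z := by
        simp [runProgram, Instruction.emit, threeCycle, hs, ht]
      rw [runProgram_append, hpF, this, Formula.eval]
      cases F.eval v <;> simp [threeCycle_mul_reverse]
  | and F G ihF ihG =>
    obtain ⟨u, v, ⟨hxu, huz⟩, ⟨hyv, hzv⟩, h⟩ := threeCycle_eq_commutator x y z hxy hyz hxz
    obtain ⟨p₁, hp₁, h₁⟩ := ihF hxu huz hxz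
    obtain ⟨p₂, hp₂, h₂⟩ := ihG hyz.symm hyv hzv
    obtain ⟨p₃, hp₃, h₃⟩ := ihF huz.symm hxu.symm hxz.symm
    obtain ⟨p₄, hp₄, h₄⟩ := ihG hyv.symm hyz hzv.symm
    refine ⟨p₁ ++ p₂ ++ p₃ ++ p₄, ?_, fun w => ?_⟩
    · have hF : 4 ^ F.depth ≤ 4 ^ max F.depth G.depth :=
        Nat.pow_le_pow_right (by norm_num) (le_max_left _ _)
      have hG : 4 ^ G.depth ≤ 4 ^ max F.depth G.depth :=
        Nat.pow_le_pow_right (by norm_num) (le_max_right _ _)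
      simp only [List.length_append, Formula.depth, pow_succ]
      omega
    · simp only [runProgram_append, h₁, h₂, h₃, h₄, Formula.eval]
      by_cases hF : F.eval w = true <;> by_cases hG : G.eval w = true <;>
        simp [hF, hG, threeCycle_mul_reverse, h]

theorem ac0Reduces_swapTracking {P : DecisionProblem} (hP : P ∈ NC1) :
    AC0Reduces P swapTracking := by
  obtain ⟨c, hc⟩ := hasLogDepthFormulas_of_mem_NC1 hP
  choose F hF hFP using hc
  -- The program must compose to the identity on the words of `P`, hence the negation.
  choose p hp hpF using fun n => exists_program (.not (F n)) (x := 0) (y := 1) (z := 2)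
    (by decide) (by decide) (by decide)
  let f (n : ℕ) (w : Fin n → P.alphabet) (j : Fin (p n).length) : Swap :=
    ((p n).get j).emit (letters w)
  have hbit (n : ℕ) (o : Fin (p n).length × Swap) :
      HasDepth letters (fun w => letters (f n w) o) 5 := by
    obtain ⟨j, b⟩ := o
    let a := (p n).get j
    have h : HasDepth letters (fun w => a.1.elim true (letters w)) 0 := by
      cases a.1 with
      | none => exact HasDepth.const true 0
      | some i => exact HasDepth.var i 0
    refine (h.ite (HasDepth.const (letters (fun _ : Fin 1 => a.2.1) (0, b)) 0)
      (HasDepth.const (letters (fun _ : Fin 1 => a.2.2) (0, b)) 0)).congr fun w => ?_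
    simp only [letters, f, Instruction.emit, a]
    split <;> exact decide_eq_decide.mpr Iff.rfl
  choose C hsize hdepth hgate heval using fun n => Circuit.exists_of_hasDepth (hbit n)
  have hlen : PolyBounded fun n => (p n).length := by
    refine polyBounded_iff.mpr ⟨2 * c + 3, fun n => (hp n).trans ?_⟩
    rw [Formula.depth, show (4 : ℕ) = 2 ^ 2 from rfl, ← pow_mul, ← pow_succ']
    refine Nat.pow_le_pow_right two_pos ?_
    have := hF n
    nlinarith
  refine ⟨fun n => (p n).length, f, C, hlen, ?_, ⟨6, hdepth⟩, fun n i => (hgate n i).1,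
    fun n w => funext fun o => heval n w o, fun n w => ?_⟩
  · refine (hlen.const_mul (Fintype.card Swap * 2 ^ (5 + 1))).mono fun n => (hsize n).trans ?_
    rw [Fintype.card_prod, Fintype.card_fin]
    exact le_of_eq (by ring)
  · have hrun : ((List.ofFn (f n w)).map Swap.perm).prod = runProgram (letters w) (p n) := by
      rw [runProgram, List.map_ofFn]
      conv_rhs => rw [← List.ofFn_get (p n), List.map_ofFn]
      rfl
    change _ ↔ ((List.ofFn (f n w)).map Swap.perm).prod = 1
    rw [hrun, hpF, Formula.eval, hFP, ← DecisionProblem.indicator_eq_true_iff]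
    have : threeCycle 0 1 2 ≠ 1 := by unfold threeCycle; decide
    cases P.indicator n w <;> simp [this]

theorem nc1Complete_swapTracking : NC1Complete swapTracking :=
  ⟨swapTracking_mem_NC1, fun _ => ac0Reduces_swapTracking⟩

/-- If swap tracking were in `TC⁰`, so would be every problem in `NC¹`. -/
theorem swapTracking_notMem_TC0 (h : TC0 ≠ NC1) : swapTracking ∉ TC0 := fun hQ =>
  h (TC0_subset_NC1.antisymm fun _ hP => (ac0Reduces_swapTracking hP).mem_TC0 hQ)

end CircuitComplexity

noncomputable section

namespace RWKV7

/-! ### Swaps as transitions of the state -/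

/-- Without weight and bias, layer normalization centres a vector and rescales it by a positive
number. -/
theorem exists_layerNorm_eq {ι : Type} [Fintype ι] {ε : ℝ} (hε : 0 ≤ ε) (x : ι → ℝ) :
    ∃ C > 0, ∀ i, layerNorm ε 1 0 x i = C * (x i - mean x) := by
  have hsum : 0 ≤ ∑ i, (x i - mean x) ^ 2 := Finset.sum_nonneg fun i _ => sq_nonneg _
  have hvar : 0 ≤ var x := div_nonneg hsum (Nat.cast_nonneg _)
  rcases (add_nonneg hvar hε).eq_or_lt with h | h
  · -- The vector is constant, and both sides vanish.
    refine ⟨1, one_pos, fun i => ?_⟩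
    have hcard : (Fintype.card ι : ℝ) ≠ 0 := Nat.cast_ne_zero.mpr (Fintype.card_pos_iff.mpr ⟨i⟩).ne'
    have h0 : var x = 0 := by linarith
    rw [var, div_eq_zero_iff, or_iff_left hcard,
      Finset.sum_eq_zero_iff_of_nonneg fun i _ => sq_nonneg _] at h0
    have := pow_eq_zero_iff two_ne_zero |>.mp (h0 i (Finset.mem_univ i))
    simp [layerNorm, this]
  · refine ⟨(√(var x + ε))⁻¹, inv_pos.mpr (Real.sqrt_pos.mpr h), fun i => ?_⟩
    simp only [layerNorm, Pi.one_apply, Pi.zero_apply, mul_one, add_zero]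
    rw [div_eq_inv_mul]

theorem exists_layerNorm_eq_smul {ι : Type} [Fintype ι] {ε : ℝ} (hε : 0 ≤ ε) {x : ι → ℝ}
    (hx : mean x = 0) : ∃ C > (0 : ℝ), layerNorm ε 1 0 x = C • x := by
  obtain ⟨C, hC, h⟩ := exists_layerNorm_eq hε x
  exact ⟨C, hC, funext fun i => by simp [h, hx]⟩

/-- If the removal key is a multiple of `e_i - e_j`, and the decay and the in-context learning rate
are the same constant `b`, then the transition with multiplier `2` is `b` times the Householder
reflection that swaps the coordinates `i` and `j`. -/
theorem vecMul_transition_swap {N : ℕ} {i j : Fin N} (hij : i ≠ j) {c : ℝ} (hc : 0 < c) (b : ℝ)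
    (q : Fin N → ℝ) :
    q ᵥ* transition 2 (fun _ => b) (normalize (c • (Pi.single i 1 - Pi.single j 1)))
      (fun _ => b) = b • (q ∘ Equiv.swap i j) := by
  set d : Fin N → ℝ := Pi.single i 1 - Pi.single j 1 with hd
  have hdd : ∑ m, (c • d) m ^ 2 = c ^ 2 * 2 := by
    have : ∀ m, (c • d) m ^ 2 = c ^ 2 * (d m * d m) := fun m => by
      simp only [Pi.smul_apply, smul_eq_mul]
      ring
    simp only [this, ← Finset.mul_sum]
    congr 1
    change d ⬝ᵥ d = 2
    simp [hd, dotProduct_sub, hij, hij.symm]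
    norm_num
  have hκ : normalize (c • d) = (√2)⁻¹ • d := by
    funext m
    rw [normalize, hdd, Real.sqrt_mul (sq_nonneg c), Real.sqrt_sq hc.le]
    simp only [Pi.smul_apply, smul_eq_mul]
    field_simp
  have h2 : (√2 : ℝ)⁻¹ * (√2)⁻¹ = 1 / 2 := by
    rw [← mul_inv, Real.mul_self_sqrt zero_le_two, one_div]
  have hqd : q ⬝ᵥ d = q i - q j := by simp [hd, dotProduct_sub]
  rw [hκ, transition, Matrix.vecMul_sub, Matrix.vecMul_smul, Matrix.vecMul_vecMulVec]
  funext m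
  simp only [Pi.sub_apply, Matrix.vecMul_diagonal, Pi.smul_apply, smul_eq_mul, Pi.mul_apply,
    dotProduct_smul, hqd, Function.comp_apply]
  have hswap : q (Equiv.swap i j m) = q m - (q i - q j) * d m := by
    rcases eq_or_ne m i with rfl | hi
    · simp [hd, hij]
    · rcases eq_or_ne m j with rfl | hj
      · simp [hd, hi]
      · simp [hd, hi, hj, Equiv.swap_apply_of_ne_of_ne hi hj]
  rw [hswap]
  linear_combination (-2 * b * d m * (q i - q j)) * h2

/-- A head that is initialized by its first token, and whose later tokens have value `0` and swap
coordinates, keeps a permuted copy of the first key, up to decay. -/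
theorem wkv_eq_of_swaps {N : ℕ} {b : ℝ} {w κ a v k : ℕ → Fin N → ℝ} {T : ℕ} {i j : ℕ → Fin N}
    {c : ℕ → ℝ} {σ : ℕ → Equiv.Perm (Fin N)} (hw : ∀ t, w t = fun _ => b)
    (ha : ∀ t, a t = fun _ => b) (hij : ∀ t < T, i t ≠ j t) (hc : ∀ t < T, 0 < c t)
    (hκ : ∀ t < T, κ (t + 1) = normalize (c t • (Pi.single (i t) 1 - Pi.single (j t) 1)))
    (hv : ∀ t < T, v (t + 1) = 0) (hσ₀ : σ 0 = 1)
    (hσ : ∀ t < T, σ (t + 1) = σ t * Equiv.swap (i t) (j t)) :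
    ∀ t ≤ T, wkv 2 w κ a v k (t + 1) = Matrix.vecMulVec (v 0) (b ^ t • (k 0 ∘ σ t)) := by
  intro t ht
  induction t with
  | zero => simp [wkv, hσ₀]
  | succ t ih =>
    rw [wkv, ih (by omega), hv t ht, Matrix.zero_vecMulVec, add_zero, Matrix.vecMulVec_mul, hw, ha,
      hκ t ht, Matrix.smul_vecMul, vecMul_transition_swap (hij t ht) (hc t ht), hσ t ht, smul_smul,
      pow_succ]
    rfl

/-! ### The model -/

/-- The channels that represent the five elements. -/
def element : Fin 5 ↪ Fin 8 := Fin.castLEEmb (by norm_num)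

/-- A channel that is nonzero for the beginning-of-sequence token only. -/
def startChannel : Channel 1 8 := (0, 6)

/-- The channel that receives the answer; it is zero in all embeddings. -/
def answerChannel : Channel 1 8 := (0, 5)

/-- The embedding of the tokens: a swap `[x ↔ y]` is `e_x - e_y`. All embeddings have mean zero,
so that layer normalization only rescales them. -/
def embedToken : Option CircuitComplexity.Swap → Vec 1 8
  | none => Pi.single startChannel 1 - Pi.single (0, 7) 1
  | some s => Pi.single (0, element s.1.1) 1 - Pi.single (0, element s.1.2) 1

/-- The key that the beginning-of-sequence token writes (on top of its embedding): distinct numbers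
for the five elements, and the constant `1`, which no swap moves, for comparison. -/
def startKey : Vec 1 8 := fun p => ![1, 2, 3, 4, 5, 1, 0, 0] p.2

/-- The direction of the receptance. By the rearrangement inequality, its product with the permuted
key is positive for the identity and negative for any other permutation. -/
def probe : Vec 1 8 := fun p => ![1, 2, 3, 4, 5, -(109 / 2), 0, 0] p.2

/-- A linear functional that is positive on the embeddings of all tokens. -/
def tokenWeight : Vec 1 8 := fun p => ![5, 4, 3, 2, 1, 0, 1, 0] p.2

/-- The decay, which is also the in-context learning rate. -/
def rate : ℝ := Real.exp (-Real.exp (-(1 / 2)) * Real.sigmoid 0)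

/-- The bias that makes the in-context learning rate equal to the decay. -/
def rateBias : ℝ := Real.log (rate / (1 - rate))

theorem rate_pos : 0 < rate := Real.exp_pos _

theorem sigmoid_rateBias : Real.sigmoid rateBias = rate := by
  have h1 : rate < 1 := Real.exp_lt_one_iff.mpr (by
    have := mul_pos (Real.exp_pos (-(1 / 2))) (Real.sigmoid_pos 0)
    linarith)
  have := rate_pos
  rw [Real.sigmoid_def, rateBias, Real.exp_neg, Real.exp_log (div_pos this (sub_pos.mpr h1))]
  field_simp
  ring

/-- A layer normalization without weight and bias. -/
def unitNorm : NormParams 1 8 := ⟨1, 0⟩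

/-- A perceptron with value `0`. -/
def zeroLora : LoraMLP 1 8 := ⟨1, 0, 0⟩

/-- The layer of the model. Token shifts, the bonus and the MLP are switched off. The embedding of a
swap is its removal key, and only the beginning-of-sequence token has a nonzero value. The
receptance of every token is a positive multiple of `probe`, and the output gate is constant. -/
def trackingLayer : LayerParams 1 8 where
  lnTime := unitNorm
  μr := 0
  μk := 0
  μv := 0
  μd := 0
  μa := 0
  μg := 0
  loraA := zeroLora
  biasA := fun _ => rateBias
  loraν := zeroLora
  biasν := 0
  loraD := zeroLora
  biasD := 0
  loraG := ⟨1, 0, fun _ _ => 1⟩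
  Wk := 1 + Matrix.vecMulVec (Pi.single startChannel 1) startKey
  Wv := Matrix.vecMulVec (Pi.single startChannel 1) (Pi.single startChannel 1)
  Wr := Matrix.vecMulVec tokenWeight probe
  Wo := Matrix.vecMulVec (Pi.single startChannel 1) (Pi.single answerChannel 1)
  ξ := 1
  α := 0
  ρ := 0
  lnHead := unitNorm
  lnChan := unitNorm
  μk' := 0
  Wk' := 0
  Wv' := 0

/-- The one-layer model that tracks swaps. Its logit for the label `0` is always `0`. -/
def trackingModel : Model (Option CircuitComplexity.Swap) (Fin 2) where
  heads := 1
  headSize := 8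
  numLayers := 1
  embedding := embedToken
  lnPre := unitNorm
  layers _ := trackingLayer
  lnOut := unitNorm
  head := Matrix.vecMulVec (Pi.single answerChannel 1) (Pi.single 1 1)

open CircuitComplexity (Swap Swap.perm)

/-! ### The activations of the model -/

theorem mean_smul {ι : Type} [Fintype ι] (c : ℝ) (x : ι → ℝ) : mean (c • x) = c * mean x := by
  simp only [mean, Pi.smul_apply, smul_eq_mul, ← Finset.mul_sum, mul_div_assoc]

theorem mean_embedToken (a : Option Swap) : mean (embedToken a) = 0 := by
  cases a <;> simp [mean, embedToken]

theorem embedToken_none_start : embedToken none startChannel = 1 := by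
  simp [embedToken, startChannel]

theorem embedToken_some_start (s : Swap) : embedToken (some s) startChannel = 0 := by
  have h (x : Fin 5) : (6 : Fin 8) ≠ element x := by fin_cases x <;> decide
  simp [embedToken, startChannel, h]

theorem embedToken_answer (a : Option Swap) : embedToken a answerChannel = 0 := by
  have h (x : Fin 5) : (5 : Fin 8) ≠ element x := by fin_cases x <;> decide
  cases a <;> simp [embedToken, startChannel, answerChannel, h]

theorem embedToken_dotProduct_tokenWeight_pos (a : Option Swap) :
    0 < embedToken a ⬝ᵥ tokenWeight := by
  cases a with
  | none => simp [embedToken, startChannel, tokenWeight, sub_dotProduct]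
  | some s =>
    have h (x : Fin 5) : tokenWeight (0, element x) = 5 - (x : ℕ) := by
      fin_cases x <;> simp [tokenWeight, element] <;> norm_num
    have : ((s.1.1 : ℕ) : ℝ) < (s.1.2 : ℕ) := Nat.cast_lt.mpr s.2
    simp only [embedToken, sub_dotProduct, single_one_dotProduct, h]
    linarith

theorem shift_zero {h N : ℕ} (x : Stream h N) : shift 0 x = x := by
  funext t
  simp [shift, lerp]

theorem zeroLora_apply (f : ℝ → ℝ) (x : Vec 1 8) : zeroLora.apply f x = 0 := by
  exact Matrix.vecMul_zero _

namespace trackingLayer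

variable (y : Stream 1 8) (t : ℕ)

theorem decay_eq (p : Channel 1 8) : trackingLayer.decay y t p = rate := by
  simp only [LayerParams.decay, trackingLayer, zeroLora_apply, rate, Pi.zero_apply, add_zero]

theorem iclr_eq (p : Channel 1 8) : trackingLayer.iclr y t p = rate := by
  simp only [LayerParams.iclr, trackingLayer, zeroLora_apply, Pi.zero_apply, zero_add,
    sigmoid_rateBias]

theorem key_eq : trackingLayer.key y t = y t + y t startChannel • startKey := by
  simp [LayerParams.key, trackingLayer, shift_zero, Matrix.vecMul_add, Matrix.vecMul_vecMulVec]

theorem removalKey_eq : trackingLayer.removalKey y t = trackingLayer.key y t := by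
  rw [LayerParams.removalKey]
  simp [trackingLayer]

theorem replacementKey_eq : trackingLayer.replacementKey y t = trackingLayer.key y t := by
  rw [LayerParams.replacementKey]
  simp [trackingLayer, lerp]

theorem value_eq : trackingLayer.value y none t =
    y t startChannel • Pi.single startChannel 1 := by
  simp [LayerParams.value, LayerParams.valuePre, trackingLayer, shift_zero,
    Matrix.vecMul_vecMulVec]

theorem receptance_eq : trackingLayer.receptance y t = (y t ⬝ᵥ tokenWeight) • probe := by
  simp [LayerParams.receptance, trackingLayer, shift_zero, Matrix.vecMul_vecMulVec]

theorem gate_eq : trackingLayer.gate y t = fun _ => 1 / 2 := by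
  funext p
  simp only [LayerParams.gate, LoraMLP.apply, Matrix.vecMul, dotProduct]
  simp [trackingLayer]
  exact Finset.card_univ.trans (Fintype.card_fin 1)

theorem bonus_eq (j : Fin 1) : trackingLayer.bonus y none t j = 0 := by
  funext i
  simp [LayerParams.bonus, trackingLayer]

theorem timeMix_eq (c ε : ℝ) : trackingLayer.timeMix y c ε none t =
    (1 / 2 * trackingLayer.attention y c ε none t startChannel) • Pi.single answerChannel 1 := by
  rw [LayerParams.timeMix, gate_eq]
  change _ ᵥ* Matrix.vecMulVec (Pi.single startChannel 1) (Pi.single answerChannel 1) = _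
  simp [Matrix.vecMul_vecMulVec]

theorem channelMix_eq : trackingLayer.channelMix y t = 0 := by
  simp [LayerParams.channelMix, trackingLayer]

end trackingLayer

/-! ### The readout decides the word problem -/

/-- The key of the beginning-of-sequence token, up to a positive factor. -/
def initialKey : Fin 8 → ℝ := fun i => embedToken none (0, i) + startKey (0, i)

/-- The sum `∑ i * π i`, over `1, …, 5`, attains its maximum `55` for the identity only. -/
theorem sum_mul_perm_le : ∀ π : Equiv.Perm (Fin 5), π ≠ 1 →
    ∑ i : Fin 5, ((i : ℕ) + 1) * ((π i : ℕ) + 1) ≤ 54 := by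
  decide +kernel

theorem initialKey_dotProduct_probe (π : Equiv.Perm (Fin 5)) :
    (initialKey ∘ Equiv.Perm.viaEmbeddingHom element π) ⬝ᵥ (fun i => probe (0, i)) =
      ((∑ i : Fin 5, ((i : ℕ) + 1) * ((π i : ℕ) + 1) : ℕ) : ℝ) - 109 / 2 := by
  have hel (x : Fin 5) : initialKey (element x) = (x : ℕ) + 1 := by
    fin_cases x <;> simp [initialKey, element, embedToken, startChannel, startKey] <;> norm_num
  have hmap (x : Fin 5) :
      Equiv.Perm.viaEmbeddingHom element π (element x) = element (π x) :=
    Equiv.Perm.viaEmbedding_apply π element x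
  have hfix : Equiv.Perm.viaEmbeddingHom element π 5 = 5 :=
    Equiv.Perm.viaEmbedding_apply_of_notMem π element 5 (by
      rintro ⟨x, hx⟩
      revert hx
      fin_cases x <;> decide)
  have h0 := hmap 0
  have h1 := hmap 1
  have h2 := hmap 2
  have h3 := hmap 3
  have h4 := hmap 4
  have h5 : initialKey 5 = 1 := by
    simp [initialKey, embedToken, startChannel, startKey]
  change Equiv.Perm.viaEmbeddingHom element π 0 = _ at h0
  change Equiv.Perm.viaEmbeddingHom element π 1 = _ at h1
  change Equiv.Perm.viaEmbeddingHom element π 2 = _ at h2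
  change Equiv.Perm.viaEmbeddingHom element π 3 = _ at h3
  change Equiv.Perm.viaEmbeddingHom element π 4 = _ at h4
  simp only [dotProduct, Fin.sum_univ_eight, Fin.sum_univ_five, Function.comp_apply, h0, h1, h2,
    h3, h4, hfix, hel, h5]
  simp [probe]
  ring

theorem initialKey_dotProduct_probe_pos :
    0 < (initialKey ∘ Equiv.Perm.viaEmbeddingHom element 1) ⬝ᵥ (fun i => probe (0, i)) := by
  rw [initialKey_dotProduct_probe, show (∑ i : Fin 5, ((i : ℕ) + 1) *
    (((1 : Equiv.Perm (Fin 5)) i : ℕ) + 1)) = 55 from by decide]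
  norm_num

theorem initialKey_dotProduct_probe_neg {π : Equiv.Perm (Fin 5)} (hπ : π ≠ 1) :
    (initialKey ∘ Equiv.Perm.viaEmbeddingHom element π) ⬝ᵥ (fun i => probe (0, i)) < 0 := by
  rw [initialKey_dotProduct_probe]
  have : ((∑ i : Fin 5, ((i : ℕ) + 1) * ((π i : ℕ) + 1) : ℕ) : ℝ) ≤ (54 : ℕ) :=
    Nat.cast_le.mpr (sum_mul_perm_le π hπ)
  push_cast at this ⊢
  linarith

theorem viaEmbeddingHom_swap (x y : Fin 5) :
    Equiv.Perm.viaEmbeddingHom element (Equiv.swap x y) =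
      Equiv.swap (element x) (element y) := by
  ext1 z
  by_cases hz : z ∈ Set.range element
  · obtain ⟨z, rfl⟩ := hz
    rw [Equiv.Perm.viaEmbeddingHom_apply, Equiv.Perm.viaEmbedding_apply,
      ← element.injective.map_swap]
  · rw [Equiv.Perm.viaEmbeddingHom_apply, Equiv.Perm.viaEmbedding_apply_of_notMem _ _ _ hz,
      Equiv.swap_apply_of_ne_of_ne]
    exacts [fun h => hz ⟨x, h.symm⟩, fun h => hz ⟨y, h.symm⟩]

/-- The inputs of the layer on a word: up to positive factors, the embeddings of the
beginning-of-sequence token and of the letters. -/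
structure IsInput (w : List Swap) (y : Stream 1 8) : Prop where
  start : ∃ c > (0 : ℝ), y 0 = c • embedToken none
  letter : ∀ t, ∀ h : t < w.length, ∃ c > (0 : ℝ), y (t + 1) = c • embedToken (some w[t])

/-- After the word `w` the state is the rank-one matrix with the key permuted by `w`. -/
theorem IsInput.state_eq {w : List Swap} {y : Stream 1 8} (hy : IsInput w y) :
    ∃ C > (0 : ℝ), trackingLayer.state y 2 none 0 (w.length + 1) =
      Matrix.vecMulVec (Pi.single 6 1)
        (C • (initialKey ∘ Equiv.Perm.viaEmbeddingHom element (w.map Swap.perm).prod)) := by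
  obtain ⟨c₀, hc₀, h₀⟩ := hy.start
  have hletter : ∀ t, ∃ c : ℝ, ∃ s : Swap, 0 < c ∧
      (t < w.length → y (t + 1) = c • embedToken (some s) ∧ w[t]? = some s) := fun t => by
    by_cases h : t < w.length
    · obtain ⟨c, hc, hyc⟩ := hy.letter t h
      exact ⟨c, w[t], hc, fun _ => ⟨hyc, List.getElem?_eq_getElem h⟩⟩
    · exact ⟨1, ⟨(0, 1), by decide⟩, one_pos, fun h' => absurd h' h⟩
  choose c s hc hs using hletter
  have hstate := wkv_eq_of_swaps (N := 8) (b := rate)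
    (w := fun t i => trackingLayer.decay y t (0, i))
    (a := fun t i => trackingLayer.iclr y t (0, i))
    (κ := fun t => normalize fun i => trackingLayer.removalKey y t (0, i))
    (v := fun t i => trackingLayer.value y none t (0, i))
    (k := fun t i => trackingLayer.replacementKey y t (0, i))
    (T := w.length) (i := fun t => element (s t).1.1) (j := fun t => element (s t).1.2) (c := c)
    (σ := fun t => Equiv.Perm.viaEmbeddingHom element ((w.take t).map Swap.perm).prod)
    (fun t => funext fun i => trackingLayer.decay_eq y t _)
    (fun t => funext fun i => trackingLayer.iclr_eq y t _)
    (fun t _ => element.injective.ne (s t).2.ne) (fun t _ => hc t) (fun t ht => ?_)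
    (fun t ht => ?_) (by simp) (fun t ht => ?_) w.length le_rfl
  · refine ⟨c₀ * (rate ^ w.length * c₀), by have := rate_pos; positivity, ?_⟩
    refine hstate.trans ?_
    have hv : (fun i => trackingLayer.value y none 0 (0, i)) = c₀ • Pi.single (6 : Fin 8) 1 := by
      funext i
      rw [trackingLayer.value_eq, h₀, Pi.smul_apply, Pi.smul_apply, embedToken_none_start]
      simp [startChannel, Pi.single_apply]
    have hk : (fun i => trackingLayer.replacementKey y 0 (0, i)) = c₀ • initialKey := by
      funext i
      rw [trackingLayer.replacementKey_eq, trackingLayer.key_eq, h₀]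
      simp [embedToken_none_start, initialKey, mul_add]
    simp only [hv, hk, List.take_length]
    rw [Matrix.smul_vecMulVec, ← Matrix.vecMulVec_smul, mul_smul, mul_smul]
    rfl
  · simp only [trackingLayer.removalKey_eq, trackingLayer.key_eq, (hs t ht).1]
    congr 1
    funext i
    rw [Pi.smul_apply _ _ startChannel, embedToken_some_start]
    simp [embedToken, Pi.single_apply]
  · funext i
    simp [trackingLayer.value_eq, (hs t ht).1, embedToken_some_start]
  · rw [← viaEmbeddingHom_swap, ← map_mul, List.take_add_one, (hs t ht).2]
    simp [Swap.perm]

/-- The answer that the head computes for the word `w` has the sign of the readout of the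
permuted key. -/
theorem IsInput.attention_eq {w : List Swap} {y : Stream 1 8} (hy : IsInput w y) {ε : ℝ}
    (hε : 0 ≤ ε) : ∃ C > (0 : ℝ), trackingLayer.attention y 2 ε none w.length startChannel =
      C * ((initialKey ∘ Equiv.Perm.viaEmbeddingHom element (w.map Swap.perm).prod) ⬝ᵥ
        (fun i => probe (0, i))) := by
  obtain ⟨C, hC, hstate⟩ := hy.state_eq
  have hr : 0 < y w.length ⬝ᵥ tokenWeight := by
    obtain ⟨c, hc, a, h⟩ : ∃ c > (0 : ℝ), ∃ a, y w.length = c • embedToken a := by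
      rcases Nat.eq_zero_or_pos w.length with h | h
      · obtain ⟨c, hc, h₀⟩ := hy.start
        exact ⟨c, hc, _, h ▸ h₀⟩
      · obtain ⟨c, hc, h₁⟩ := hy.letter (w.length - 1) (by omega)
        rw [Nat.sub_add_cancel h] at h₁
        exact ⟨c, hc, _, h₁⟩
    rw [h, smul_dotProduct, smul_eq_mul]
    exact mul_pos hc (embedToken_dotProduct_tokenWeight_pos a)
  set S := (initialKey ∘ Equiv.Perm.viaEmbeddingHom element (w.map Swap.perm).prod) ⬝ᵥ
    (fun i => probe (0, i)) with hS
  have hread : (fun i => trackingLayer.receptance y w.length (0, i)) ᵥ*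
      (trackingLayer.state y 2 none 0 (w.length + 1))ᵀ =
      ((y w.length ⬝ᵥ tokenWeight) * (C * S)) • Pi.single (6 : Fin 8) 1 := by
    have : (fun i => trackingLayer.receptance y w.length (0, i)) =
        (y w.length ⬝ᵥ tokenWeight) • fun i => probe (0, i) := by
      funext i
      rw [trackingLayer.receptance_eq]
      rfl
    rw [Matrix.vecMul_transpose, hstate, this, Matrix.vecMulVec_mulVec, dotProduct_smul,
      smul_dotProduct, ← hS]
    funext i
    simp [mul_comm]
  obtain ⟨D, hD, hnorm⟩ := exists_layerNorm_eq hε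
    (((y w.length ⬝ᵥ tokenWeight) * (C * S)) • Pi.single (6 : Fin 8) (1 : ℝ))
  refine ⟨D * ((y w.length ⬝ᵥ tokenWeight) * C * (7 / 8)), by positivity, ?_⟩
  have hatt : trackingLayer.attention y 2 ε none w.length startChannel =
      layerNorm ε 1 0 ((fun i => trackingLayer.receptance y w.length (0, i)) ᵥ*
        (trackingLayer.state y 2 none 0 (w.length + 1))ᵀ) 6 +
        trackingLayer.bonus y none w.length 0 6 := rfl
  rw [hatt, trackingLayer.bonus_eq, hread, hnorm, mean_smul]
  simp [mean]
  ring

/-- The residual stream of the model in front of its layer. -/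
def embedding (ε : ℝ) (w : List (Option Swap)) : Stream 1 8 := trackingModel.embed ε w

theorem embedding_zero (ε : ℝ) (w : List Swap) :
    embedding ε (encode w) 0 = unitNorm.apply ε (embedToken none) := rfl

theorem embedding_succ (ε : ℝ) (w : List Swap) {t : ℕ} (ht : t < w.length) :
    embedding ε (encode w) (t + 1) =
      unitNorm.apply ε (embedToken (some w[t])) := by
  have : (encode w)[t + 1]? = some (some w[t]) := by
    simp [encode, ht]
  simp only [embedding, Model.embed, this]
  rfl

theorem embedding_eq_smul {ε : ℝ} (hε : 0 ≤ ε) (w : List Swap) {t : ℕ} (ht : t ≤ w.length) :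
    ∃ c > (0 : ℝ), ∃ a, embedding ε (encode w) t = c • embedToken a := by
  cases t with
  | zero =>
    obtain ⟨c, hc, h⟩ := exists_layerNorm_eq_smul hε (mean_embedToken none)
    exact ⟨c, hc, none, (embedding_zero ε w).trans h⟩
  | succ t =>
    obtain ⟨c, hc, h⟩ := exists_layerNorm_eq_smul hε (mean_embedToken (some w[t]))
    exact ⟨c, hc, _, (embedding_succ ε w ht).trans h⟩

theorem isInput_embedding {ε : ℝ} (hε : 0 ≤ ε) (w : List Swap) :
    IsInput w fun t => unitNorm.apply ε (embedding ε (encode w) t) := by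
  have norm_twice (a : Option Swap) : ∃ c > (0 : ℝ),
      unitNorm.apply ε (unitNorm.apply ε (embedToken a)) = c • embedToken a := by
    obtain ⟨c, hc, h⟩ := exists_layerNorm_eq_smul hε (mean_embedToken a)
    obtain ⟨c', hc', h'⟩ := exists_layerNorm_eq_smul hε (x := c • embedToken a)
      (by rw [mean_smul, mean_embedToken, mul_zero])
    have e : unitNorm.apply ε (embedToken a) = c • embedToken a := h
    have e' : unitNorm.apply ε (c • embedToken a) = c' • c • embedToken a := h'
    exact ⟨c' * c, mul_pos hc' hc, by rw [mul_smul, e, e']⟩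
  refine ⟨?_, fun t ht => ?_⟩
  · simp only [embedding_zero]
    exact norm_twice none
  · simp only [embedding_succ ε w ht]
    exact norm_twice _

theorem logits_eq (c ε ε' : ℝ) (w : List (Option Swap)) : trackingModel.logits c ε ε' w =
    layerNorm ε 1 0 ((trackingLayer.step c ε ε' (embedding ε w, none)).1 (w.length - 1))
      answerChannel • Pi.single 1 1 := by
  refine (Matrix.vecMul_vecMulVec (m := Channel 1 8) _ _ _).trans ?_
  exact congrArg (· • _) (dotProduct_single_one (n := Channel 1 8) _ _)

theorem step_eq (c ε ε' : ℝ) (x : Stream 1 8) (t : ℕ) :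
    (trackingLayer.step c ε ε' (x, none)).1 t = x t +
      (1 / 2 * trackingLayer.attention (fun t => unitNorm.apply ε (x t)) c ε' none t
        startChannel) • Pi.single answerChannel 1 := by
  rw [← trackingLayer.timeMix_eq]
  refine Eq.trans (b := x t + trackingLayer.timeMix (fun t => unitNorm.apply ε (x t)) c ε' none t
    + 0) ?_ (add_zero _)
  rw [← trackingLayer.channelMix_eq]
  rfl

/-- The logit of the label `1` has the sign of the readout of the permuted key. -/
theorem logits_one_eq {ε ε' : ℝ} (hε : 0 ≤ ε) (hε' : 0 ≤ ε') (w : List Swap) :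
    ∃ C > (0 : ℝ), trackingModel.logits 2 ε ε' (encode w) 1 =
      C * ((initialKey ∘ Equiv.Perm.viaEmbeddingHom element (w.map Swap.perm).prod) ⬝ᵥ
        (fun i => probe (0, i))) := by
  have hlen : (encode w).length - 1 = w.length := by simp [encode]
  obtain ⟨C, hC, h⟩ := (isInput_embedding hε w).attention_eq hε'
  obtain ⟨c, -, a, ha⟩ := embedding_eq_smul hε w le_rfl
  rw [logits_eq, hlen, step_eq, h, ha]
  set S := (initialKey ∘ Equiv.Perm.viaEmbeddingHom element (w.map Swap.perm).prod) ⬝ᵥ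
    (fun i => probe (0, i))
  obtain ⟨D, hD, hnorm⟩ := exists_layerNorm_eq hε
    (c • embedToken a + (1 / 2 * (C * S)) • Pi.single answerChannel 1)
  refine ⟨D * (1 / 2 * C * (7 / 8)), by positivity, ?_⟩
  have hmean : mean (c • embedToken a + (1 / 2 * (C * S)) • Pi.single answerChannel 1) =
      1 / 2 * (C * S) / 8 := by
    have := mean_embedToken a
    rw [mean, div_eq_zero_iff, or_iff_left (by simp)] at this
    simp only [mean, Pi.add_apply, Pi.smul_apply, smul_eq_mul, Finset.sum_add_distrib,
      ← Finset.mul_sum, this]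
    simp
  rw [Pi.smul_apply, hnorm, hmean, Pi.add_apply, Pi.smul_apply, embedToken_answer]
  simp
  ring

theorem logits_zero_eq (c ε ε' : ℝ) (w : List (Option Swap)) :
    trackingModel.logits c ε ε' w 0 = 0 := by
  rw [logits_eq]
  simp

theorem trackingModel_solves {ε ε' : ℝ} (hε : 0 ≤ ε) (hε' : 0 ≤ ε') :
    Model.Solves (A := Swap) trackingModel 2 ε ε'
      CircuitComplexity.swapTracking.language := by
  intro w
  obtain ⟨C, hC, h⟩ := logits_one_eq hε hε' w
  refine ⟨fun hw o ho => ?_, fun hw o ho => ?_⟩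
  · obtain rfl : o = 0 := by omega
    rw [logits_zero_eq, h, show (w.map Swap.perm).prod = 1 from hw]
    exact mul_pos hC initialKey_dotProduct_probe_pos
  · obtain rfl : o = 1 := by omega
    rw [logits_zero_eq, h]
    exact mul_neg_of_pos_of_neg hC (initialKey_dotProduct_probe_neg hw)

end RWKV7

end

theorem mainTheorem3 :
    (∀ ε ε' : ℝ, 0 ≤ ε → 0 ≤ ε' →
      ∃ M : RWKV7.Model (Option CircuitComplexity.swapTracking.alphabet) (Fin 2),
        M.numLayers = 1 ∧ M.Solves 2 ε ε' CircuitComplexity.swapTracking.language) ∧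
    CircuitComplexity.NC1Complete CircuitComplexity.swapTracking ∧
    (CircuitComplexity.TC0 ≠ CircuitComplexity.NC1 →
      CircuitComplexity.swapTracking ∉ CircuitComplexity.TC0) :=
  ⟨fun _ _ hε hε' => ⟨RWKV7.trackingModel, rfl, RWKV7.trackingModel_solves hε hε'⟩,
    CircuitComplexity.nc1Complete_swapTracking, CircuitComplexity.swapTracking_notMem_TC0⟩
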